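/- Let $\mathbb J$ be a Euclidean Jordan algebra: a finite-dimensional real inner product space with a bilinear product $\circ$ and an identity element $e$ such that, for all $x,y,z$, $x\circ y=y\circ x$, $x^2\circ(x\circ y)=x\circ(x^2\circ y)$ with $x^2=x\circ x$, $\langle x\circ y,z\rangle=\langle y,x\circ z\rangle$, and $x\circ e=x$. Let $\mathbb K=\{x\circ x: x\in\mathbb J\}$ be its symmetric cone and $\phi(x)=-\ln\det(x)$ the natural barrier on $\operatorname{int}\mathbb K$, where $\det(x)=\prod_i\lambda_i$ for any spectral decomposition $x=\sum_i\lambda_i v_i$ over a Jordan frame $\{v_i\}$ (pairwise orthogonal primitive idempotents with sum $e$). Let $\mathcal A:\mathbb J\to\mathbb R^m$ be linear and surjective with adjoint $\mathcal A^*$, and let $b\in\mathbb R^m$, $c\in\mathbb J$, $\mu>0$, $\rho>0$. For $x\in\mathbb J$, $\lambda\in\mathbb R^m$, $s\in\operatorname{int}\mathbb K$ put $$L(x,\lambda,s)=-\rho\langle b,\lambda\rangle+\rho\mu\,\phi(s)+\rho\langle x,\mathcal A^*\lambda+s-c\rangle+\tfrac12\|\mathcal A^*\lambda+s-c\|^2,$$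 and let $\eta(x,\lambda)=\min_{s\in\operatorname{int}\mathbb K}L(x,\lambda,s)$. Theorem. For all $x\in\mathbb J$ and $\lambda\in\mathbb R^m$ the minimum is attained at a unique point $s=s(x,\lambda)\in\operatorname{int}\mathbb K$, the function $\phi$ is twice continuously differentiable at $s$, and, with $W=\rho\mu\nabla^2\phi(s)$, the operator $H=I+W$ is invertible. Put $z=z(x,\lambda)=\rho x+\mathcal A^*\lambda+s(x,\lambda)-c$. Then $\eta$ is twice differentiable in $\lambda$ and in $x$ separately, with $$\nabla_\lambda\eta=-\rho b+\mathcal A z,\qquad \nabla_\lambda^2\eta=\mathcal A H^{-1}W\mathcal A^*,$$ $$\nabla_x\eta=\rho(\mathcal A^*\lambda+s-c),\qquad \nabla_x^2\eta=-\rho^2H^{-1}$$ at every $(x,\lambda)$. Moreover $\eta(x,\cdot)$ is strictly convex on $\mathbb R^m$ for every $x\in\mathbb J$, and $\eta(\cdot,\lambda)$ is strictly concave on $\mathbb J$ for every $\lambda\in\mathbb R^m$. -/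

import Mathlib

/-- A Euclidean Jordan algebra structure on a (finite-dimensional) real inner product space `J`:
a bilinear commutative product with unit that satisfies the Jordan identity and for which every
multiplication operator is symmetric with respect to the inner product. -/
structure EuclideanJordanAlgebra (J : Type*) [NormedAddCommGroup J] [InnerProductSpace ℝ J] where
  /-- the Jordan product `x ∘ y` -/
  mul : J →ₗ[ℝ] J →ₗ[ℝ] J
  /-- the identity element `e` -/
  one : J
  mul_comm : ∀ x y : J, mul x y = mul y x
  jordan : ∀ x y : J, mul (mul x x) (mul x y) = mul x (mul (mul x x) y)
  inner_mul : ∀ x y z : J, inner ℝ (mul x y) z = inner ℝ y (mul x z)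
  mul_one : ∀ x : J, mul x one = x

namespace EuclideanJordanAlgebra

variable {J : Type*} [NormedAddCommGroup J] [InnerProductSpace ℝ J]

/-- The symmetric cone of the algebra: the cone of squares `{x ∘ x | x ∈ J}`. -/
def cone (E : EuclideanJordanAlgebra J) : Set J := Set.range fun x : J => E.mul x x

/-- A primitive idempotent: a nonzero idempotent that is not the sum of two nonzero idempotents
(two idempotents whose sum is idempotent are automatically orthogonal). -/
def IsPrimitiveIdempotent (E : EuclideanJordanAlgebra J) (v : J) : Prop :=
  v ≠ 0 ∧ E.mul v v = v ∧
    ∀ p q : J, E.mul p p = p → E.mul q q = q → p + q = v → p = 0 ∨ q = 0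

/-- A Jordan frame: pairwise orthogonal primitive idempotents that sum to the identity. -/
def IsJordanFrame (E : EuclideanJordanAlgebra J) {r : ℕ} (v : Fin r → J) : Prop :=
  (∀ i, E.IsPrimitiveIdempotent (v i)) ∧ (∀ i j, i ≠ j → E.mul (v i) (v j) = 0) ∧
    ∑ i, v i = E.one

/-- `d` is the product of the eigenvalues of `x` in a spectral decomposition
`x = ∑ i, ev i • v i` over a Jordan frame `v`. -/
def IsDet (E : EuclideanJordanAlgebra J) (x : J) (d : ℝ) : Prop :=
  ∃ (r : ℕ) (v : Fin r → J) (ev : Fin r → ℝ),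
    E.IsJordanFrame v ∧ x = ∑ i, ev i • v i ∧ d = ∏ i, ev i

/-- The determinant of `x`: the product of its eigenvalues, which by the spectral theorem exist
and do not depend on the Jordan frame. -/
noncomputable def det (E : EuclideanJordanAlgebra J) (x : J) : ℝ :=
  Classical.epsilon (E.IsDet x)

/-- The natural barrier `φ(x) = - ln (det x)` (used on the interior of the cone). -/
noncomputable def barrier (E : EuclideanJordanAlgebra J) (x : J) : ℝ := -Real.log (E.det x)

variable [CompleteSpace J] {m : ℕ}

/-- `L(x, l, s; μ, ρ)
  = -ρ ⟨b, l⟩ + ρ μ φ(s) + ρ ⟨x, A* l + s - c⟩ + (1/2) ‖A* l + s - c‖²`. -/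
noncomputable def augLagrangian (E : EuclideanJordanAlgebra J)
    (A : J →L[ℝ] EuclideanSpace ℝ (Fin m)) (b : EuclideanSpace ℝ (Fin m)) (c : J) (μ ρ : ℝ)
    (x : J) (l : EuclideanSpace ℝ (Fin m)) (s : J) : ℝ :=
  -ρ * inner ℝ b l + ρ * μ * E.barrier s
    + ρ * inner ℝ x (ContinuousLinearMap.adjoint A l + s - c)
    + (1 / 2) * ‖ContinuousLinearMap.adjoint A l + s - c‖ ^ 2

/-- `η(x, l; μ, ρ)`: the minimum of `L(x, l, s; μ, ρ)` over `s` in the interior of the cone. -/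
noncomputable def eta (E : EuclideanJordanAlgebra J)
    (A : J →L[ℝ] EuclideanSpace ℝ (Fin m)) (b : EuclideanSpace ℝ (Fin m)) (c : J) (μ ρ : ℝ)
    (x : J) (l : EuclideanSpace ℝ (Fin m)) : ℝ :=
  sInf (E.augLagrangian A b c μ ρ x l '' interior E.cone)

/-- `s(x, l; μ, ρ)`: the minimizer of `L(x, l, ·; μ, ρ)` in the interior of the cone. -/
noncomputable def sMin (E : EuclideanJordanAlgebra J)
    (A : J →L[ℝ] EuclideanSpace ℝ (Fin m)) (b : EuclideanSpace ℝ (Fin m)) (c : J) (μ ρ : ℝ)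
    (x : J) (l : EuclideanSpace ℝ (Fin m)) : J :=
  Classical.epsilon fun s : J =>
    s ∈ interior E.cone ∧ IsMinOn (E.augLagrangian A b c μ ρ x l) (interior E.cone) s

/-- `z(x, l; μ, ρ) = ρ x + A* l + s(x, l; μ, ρ) - c`. -/
noncomputable def zVar (E : EuclideanJordanAlgebra J)
    (A : J →L[ℝ] EuclideanSpace ℝ (Fin m)) (b : EuclideanSpace ℝ (Fin m)) (c : J) (μ ρ : ℝ)
    (x : J) (l : EuclideanSpace ℝ (Fin m)) : J :=
  ρ • x + ContinuousLinearMap.adjoint A l + E.sMin A b c μ ρ x l - c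

/-- `W = ρ μ ∇²φ(s(x, l; μ, ρ))`. -/
noncomputable def opW (E : EuclideanJordanAlgebra J)
    (A : J →L[ℝ] EuclideanSpace ℝ (Fin m)) (b : EuclideanSpace ℝ (Fin m)) (c : J) (μ ρ : ℝ)
    (x : J) (l : EuclideanSpace ℝ (Fin m)) : J →L[ℝ] J :=
  (ρ * μ) • fderiv ℝ (gradient E.barrier) (E.sMin A b c μ ρ x l)

/-- `H = I + W`. -/
noncomputable def opH (E : EuclideanJordanAlgebra J)
    (A : J →L[ℝ] EuclideanSpace ℝ (Fin m)) (b : EuclideanSpace ℝ (Fin m)) (c : J) (μ ρ : ℝ)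
    (x : J) (l : EuclideanSpace ℝ (Fin m)) : J →L[ℝ] J :=
  ContinuousLinearMap.id ℝ J + E.opW A b c μ ρ x l

end EuclideanJordanAlgebra

/-! Completing the square turns `augLagrangian` into terms free of s plus ψ(s) + ½‖s − q‖², with ψ =
ρμφ and q = c − A*λ − ρx. So s(x, λ) is the proximal point σ(q) of ψ, η is the Moreau envelope of ψ
at q plus explicit terms, and z = σ(q) − q. The envelope has gradient q − σ(q), and inverting s ↦ s
+ ∇ψ(s) gives σ' = H⁻¹; the formulas then follow from the chain rule and H⁻¹W = I − H⁻¹. The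
envelope is strictly convex (`moreau_lt`), and strictly concave after subtracting ½‖·‖²
(`lt_moreau`). With A* injective the first gives convexity in λ; the second gives concavity in x,
where −½ρ²‖x‖² supplies the subtracted square.

Three facts about φ are needed: a strict subgradient inequality (`barrier_add_inner_lt`), smoothness
of the subgradient `barrierGrad`, and compactness of bounded sublevel sets
(`exists_isCompact_of_barrier_le`). The determinant is never differentiated, because a continuous
selection of subgradients is the gradient. The inequality is Klein's: for Jordan frames v, w the
weights ⟨v i, w j⟩/‖v i‖² have row and column sums 1, and the gap is the weighted sum of t − 1 − log
t over ratios t of eigenvalues. Column sums rest on `IsPrimitiveIdempotent.norm_sq_eq`. Smoothness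
comes from writing x⁻¹ = Q(x)⁻¹x with the quadratic representation Q (`isUnit_quad`). The inner
product need not be the trace form, hence the correction `traceWeight` in the gradient. -/

open Filter Topology

/-! ### Power associativity and the polynomial calculus of one element -/

namespace EuclideanJordanAlgebra

variable {J : Type*} [NormedAddCommGroup J] [InnerProductSpace ℝ J]

theorem inner_mul_left (E : EuclideanJordanAlgebra J) (x y z : J) :
    inner ℝ (E.mul x y) z = inner ℝ x (E.mul y z) := by
  rw [E.mul_comm, E.inner_mul]

protected theorem one_mul (E : EuclideanJordanAlgebra J) (x : J) : E.mul E.one x = x := by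
  rw [E.mul_comm, E.mul_one]

theorem isSymmetric_mul (E : EuclideanJordanAlgebra J) (x : J) : (E.mul x).IsSymmetric :=
  fun y z => E.inner_mul x y z

/-- The full linearisation of the Jordan identity. -/
theorem jordan_linearized (E : EuclideanJordanAlgebra J) (a b c y : J) :
    E.mul (E.mul a b) (E.mul c y) + E.mul (E.mul b c) (E.mul a y) + E.mul (E.mul c a) (E.mul b y)
      = E.mul c (E.mul (E.mul a b) y) + E.mul a (E.mul (E.mul b c) y)
        + E.mul b (E.mul (E.mul c a) y) := by
  have h1 := E.jordan (a + b + c) y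
  have h2 := E.jordan (a + b) y
  have h3 := E.jordan (b + c) y
  have h4 := E.jordan (c + a) y
  have h5 := E.jordan a y
  have h6 := E.jordan b y
  have h7 := E.jordan c y
  simp only [map_add, LinearMap.add_apply, E.mul_comm b a, E.mul_comm c b, E.mul_comm a c]
    at h1 h2 h3 h4 ⊢
  linear_combination (norm := module) (1 / 2 : ℝ) • (h1 - h2 - h3 - h4 + h5 + h6 + h7)

/-- Exchanging the roles of `y` and `z` in the linearised identity expresses multiplication by a
triple product through multiplications by shorter products. -/
theorem mul_mul_mul_apply (E : EuclideanJordanAlgebra J) (a b y z : J) :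
    E.mul (E.mul (E.mul a b) y) z
      = E.mul (E.mul a b) (E.mul y z) + E.mul (E.mul a y) (E.mul b z)
        + E.mul (E.mul b y) (E.mul a z) - E.mul a (E.mul y (E.mul b z))
        - E.mul b (E.mul y (E.mul a z)) := by
  have h := E.jordan_linearized a b z y
  rw [E.mul_comm z y, E.mul_comm z a, E.mul_comm z (E.mul (E.mul a b) y),
    E.mul_comm (E.mul b z) (E.mul a y), E.mul_comm (E.mul a z) (E.mul b y),
    E.mul_comm (E.mul b z) y, E.mul_comm (E.mul a z) y] at h
  linear_combination (norm := module) (-1 : ℝ) • h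

/-- The powers of `x`. -/
def pow (E : EuclideanJordanAlgebra J) (x : J) (n : ℕ) : J := ((E.mul x) ^ n) E.one

protected theorem pow_succ' (E : EuclideanJordanAlgebra J) (x : J) (n : ℕ) :
    E.pow x (n + 1) = E.mul x (E.pow x n) := by
  simp [pow, _root_.pow_succ']

/-- The recursion for multiplication by a power reaches back two steps, so the induction carries two
consecutive powers. -/
theorem commute_mul_pow_of_commute (E : EuclideanJordanAlgebra J) (x : J) (T : J →ₗ[ℝ] J)
    (h1 : Commute T (E.mul x)) (h2 : Commute T (E.mul (E.mul x x))) (n : ℕ) :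
    Commute T (E.mul (E.pow x n)) ∧ Commute T (E.mul (E.pow x (n + 1))) := by
  induction n with
  | zero =>
    have h0 : E.mul (E.pow x 0) = 1 := by
      ext z; simp [pow, E.one_mul]
    have h3 : E.pow x (0 + 1) = x := by simp [pow, E.mul_one]
    rw [h0, h3]
    exact ⟨Commute.one_right T, h1⟩
  | succ n ih =>
    refine ⟨ih.2, ?_⟩
    have h : E.mul (E.pow x (n + 1 + 1)) = E.mul (E.pow x (n + 1)) * E.mul x
        + E.mul (E.mul x x) * E.mul (E.pow x n) + E.mul (E.pow x (n + 1)) * E.mul x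
        - E.mul x * (E.mul x * E.mul (E.pow x n)) - E.mul (E.pow x n) * (E.mul x * E.mul x) := by
      ext z
      have := E.mul_mul_mul_apply x (E.pow x n) x z
      rw [E.mul_comm (E.pow x n) x, ← E.pow_succ', E.mul_comm (E.pow x (n + 1)) x,
        ← E.pow_succ'] at this
      simpa using this
    rw [h]
    exact ((((ih.2.mul_right h1).add_right (h2.mul_right ih.1)).add_right
      (ih.2.mul_right h1)).sub_right (h1.mul_right (h1.mul_right ih.1))).sub_right
      (ih.1.mul_right (h1.mul_right h1))

theorem commute_mul_mul_self (E : EuclideanJordanAlgebra J) (x : J) :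
    Commute (E.mul x) (E.mul (E.mul x x)) := by
  ext y
  exact (E.jordan x y).symm

/-- Evaluation of a polynomial at an element of the algebra. -/
noncomputable def polyEval (E : EuclideanJordanAlgebra J) (x : J) (p : Polynomial ℝ) : J :=
  Polynomial.aeval (R := ℝ) (A := Module.End ℝ J) (E.mul x) p E.one

theorem commute_mul_polyEval (E : EuclideanJordanAlgebra J) (x : J) (p : Polynomial ℝ) :
    Commute (E.mul x) (E.mul (E.polyEval x p)) := by
  induction p using Polynomial.induction_on' with
  | add p q hp hq =>
    have : E.polyEval x (p + q) = E.polyEval x p + E.polyEval x q := by simp [polyEval]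
    rw [this, map_add]
    exact hp.add_right hq
  | monomial n a =>
    have : E.polyEval x (Polynomial.monomial n a) = a • E.pow x n := by
      simp [polyEval, pow, Polynomial.aeval_monomial]
    rw [this, map_smul]
    exact ((E.commute_mul_pow_of_commute x _ (Commute.refl _)
      (E.commute_mul_mul_self x) n).1).smul_right a

theorem commute_aeval {A : Type*} [Ring A] [Algebra ℝ A] {a b : A} (h : Commute a b)
    (p : Polynomial ℝ) : Commute (Polynomial.aeval a p) b := by
  induction p using Polynomial.induction_on' with
  | add p q hp hq => rw [map_add]; exact hp.add_left hq
  | monomial n r =>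
    rw [Polynomial.aeval_monomial]
    exact (Algebra.commute_algebraMap_left r b).mul_left (h.pow_left n)

/-- Power associativity: q(L_x) commutes with L_{p(x)}, where L is multiplication, and both sides
are evaluated at the identity element. -/
theorem polyEval_mul (E : EuclideanJordanAlgebra J) (x : J) (p q : Polynomial ℝ) :
    E.polyEval x (p * q) = E.mul (E.polyEval x p) (E.polyEval x q) := by
  have h := commute_aeval (E.commute_mul_polyEval x p) q
  have h' := LinearMap.congr_fun h E.one
  simp only [Module.End.mul_apply, E.mul_one] at h'
  rw [_root_.mul_comm, polyEval, map_mul, Module.End.mul_apply]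
  exact h'

theorem aeval_eq_zero_of_eval_eigenvalues [FiniteDimensional ℝ J] {T : J →ₗ[ℝ] J}
    (hT : T.IsSymmetric) {p : Polynomial ℝ}
    (hp : ∀ i, p.eval (hT.eigenvalues rfl i) = 0) :
    Polynomial.aeval (R := ℝ) (A := Module.End ℝ J) T p = 0 := by
  refine (hT.eigenvectorBasis rfl).toBasis.ext fun i => ?_
  have h := Module.End.aeval_apply_of_hasEigenvector (p := p)
    (hT.hasEigenvector_eigenvectorBasis rfl i)
  simp only [OrthonormalBasis.coe_toBasis, LinearMap.zero_apply]
  rw [h]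
  simp only [RCLike.ofReal_real_eq_id, id_eq, hp i, zero_smul]

/-- The spectral theorem in terms of not necessarily primitive idempotents, all of them polynomials
in the given element. -/
theorem exists_polynomial_idempotents [FiniteDimensional ℝ J] (E : EuclideanJordanAlgebra J)
    (x : J) : ∃ (Λ : Finset ℝ) (p : ℝ → Polynomial ℝ),
      (∀ a ∈ Λ, ∀ b ∈ Λ, E.mul (E.polyEval x (p a)) (E.polyEval x (p b)) =
        if a = b then E.polyEval x (p a) else 0) ∧
      ∑ a ∈ Λ, E.polyEval x (p a) = E.one ∧ x = ∑ a ∈ Λ, a • E.polyEval x (p a) ∧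
      ∀ a ∈ Λ, Polynomial.aeval (R := ℝ) (A := Module.End ℝ J) (E.mul x) (p a * Polynomial.X)
        = a • Polynomial.aeval (R := ℝ) (A := Module.End ℝ J) (E.mul x) (p a) := by
  classical
  have hT := E.isSymmetric_mul x
  -- Lagrange polynomials on this set give the spectral projections of multiplication by `x`, which
  -- are then applied to the identity element. Some of the resulting idempotents may be 0;
  -- `exists_isSpectralSystem` discards them.
  set Λ : Finset ℝ := Finset.univ.image (hT.eigenvalues rfl) with hΛ
  have key : ∀ p q : Polynomial ℝ, (∀ a ∈ Λ, p.eval a = q.eval a) →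
      Polynomial.aeval (R := ℝ) (A := Module.End ℝ J) (E.mul x) p
        = Polynomial.aeval (R := ℝ) (A := Module.End ℝ J) (E.mul x) q := by
    intro p q h
    rw [← sub_eq_zero, ← map_sub]
    apply aeval_eq_zero_of_eval_eigenvalues hT
    intro i
    rw [Polynomial.eval_sub, h _ (Finset.mem_image_of_mem _ (Finset.mem_univ i)), sub_self]
  have hb : ∀ a ∈ Λ, ∀ b ∈ Λ, (Lagrange.basis Λ id a).eval b = if a = b then 1 else 0 := by
    intro a ha b hb
    split_ifs with h
    · subst h
      exact Lagrange.eval_basis_self (v := id) (Set.injOn_id _) ha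
    · exact Lagrange.eval_basis_of_ne (v := id) h hb
  have key' : ∀ p q : Polynomial ℝ, (∀ a ∈ Λ, p.eval a = q.eval a) →
      E.polyEval x p = E.polyEval x q := by
    intro p q h
    rw [polyEval, key p q h, polyEval]
  refine ⟨Λ, Lagrange.basis Λ id, ?_, ?_, ?_, ?_⟩
  · intro a ha b hb'
    rw [← E.polyEval_mul]
    split_ifs with h
    · subst h
      refine key' _ _ fun d hd => ?_
      rw [Polynomial.eval_mul, hb a ha d hd]
      split_ifs <;> simp
    · rw [key' _ 0 fun d hd => ?_]
      · simp [polyEval]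
      rw [Polynomial.eval_mul, hb a ha d hd, hb b hb' d hd, Polynomial.eval_zero]
      split_ifs with h1 h2 <;> simp_all
  · have := key' (∑ a ∈ Λ, Lagrange.basis Λ id a) 1 fun d hd => by
      rw [Polynomial.eval_finsetSum, Finset.sum_congr rfl fun a ha => hb a ha d hd]
      simp [hd]
    simpa [polyEval] using this
  · have := key' (∑ a ∈ Λ, a • Lagrange.basis Λ id a) Polynomial.X fun d hd => by
      simp only [Polynomial.eval_finsetSum, Polynomial.eval_smul, Polynomial.eval_X]
      rw [Finset.sum_congr rfl fun a ha => by rw [hb a ha d hd]]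
      simp [hd]
    simp only [polyEval, map_sum, map_smul, Polynomial.aeval_X, E.mul_one, LinearMap.sum_apply,
      LinearMap.smul_apply] at this
    exact this.symm
  · intro a ha
    rw [← map_smul]
    refine key _ _ fun d hd => ?_
    rw [Polynomial.eval_mul, Polynomial.eval_smul, hb a ha d hd, Polynomial.eval_X]
    split_ifs with h <;> simp [h]

/-! ### Idempotents -/

/-- This is the Peirce decomposition in disguise: multiplication by `c` has its eigenvalues among 0,
1/2, 1. -/
theorem idempotent_cubic (E : EuclideanJordanAlgebra J) {c : J} (hc : E.mul c c = c) (z : J) :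
    (2 : ℝ) • E.mul c (E.mul c (E.mul c z)) = (3 : ℝ) • E.mul c (E.mul c z) - E.mul c z := by
  have h := E.mul_mul_mul_apply c c c z
  simp only [hc] at h
  linear_combination (norm := module) (1 : ℝ) • h

/-- On the eigenvalues 0, 1/2, 1 one has t = (2t² − t)² + 8(t − t²)². This certifies positivity of
L_c; the polarised form also serves products with an operator commuting with L_c. -/
theorem idempotent_inner_mul_eq_add (E : EuclideanJordanAlgebra J) {c : J} (hc : E.mul c c = c)
    (w z : J) : inner ℝ (E.mul c w) z
      = inner ℝ ((2 : ℝ) • E.mul c (E.mul c w) - E.mul c w)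
          ((2 : ℝ) • E.mul c (E.mul c z) - E.mul c z)
        + 8 * inner ℝ (E.mul c w - E.mul c (E.mul c w)) (E.mul c z - E.mul c (E.mul c z)) := by
  have h3 := congrArg (inner ℝ · z) (E.idempotent_cubic hc w)
  have h4 := congrArg (inner ℝ · (E.mul c z)) (E.idempotent_cubic hc w)
  simp only [inner_smul_left, inner_sub_left, E.inner_mul, conj_trivial] at h3 h4
  simp only [inner_sub_left, inner_sub_right, inner_smul_left,
    inner_smul_right, E.inner_mul, conj_trivial]
  linarith

theorem idempotent_inner_mul_eq (E : EuclideanJordanAlgebra J) {c : J} (hc : E.mul c c = c)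
    (z : J) : inner ℝ (E.mul c z) z
      = ‖(2 : ℝ) • E.mul c (E.mul c z) - E.mul c z‖ ^ 2
        + 8 * ‖E.mul c z - E.mul c (E.mul c z)‖ ^ 2 := by
  rw [E.idempotent_inner_mul_eq_add hc, real_inner_self_eq_norm_sq, real_inner_self_eq_norm_sq]

theorem idempotent_inner_mul_nonneg (E : EuclideanJordanAlgebra J) {c : J} (hc : E.mul c c = c)
    (z : J) : 0 ≤ inner ℝ (E.mul c z) z := by
  rw [E.idempotent_inner_mul_eq hc]
  positivity

/-- By the cubic relation 2L_c² − L_c is the orthogonal projection onto the eigenspace of 1. -/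
theorem idempotent_two_mul_sub_nonneg (E : EuclideanJordanAlgebra J) {c : J}
    (hc : E.mul c c = c) (z : J) :
    0 ≤ inner ℝ ((2 : ℝ) • E.mul c (E.mul c z) - E.mul c z) z := by
  have h : inner ℝ ((2 : ℝ) • E.mul c (E.mul c z) - E.mul c z) z
      = ‖(2 : ℝ) • E.mul c (E.mul c z) - E.mul c z‖ ^ 2 := by
    have h3 := congrArg (inner ℝ · z) (E.idempotent_cubic hc z)
    have h4 := congrArg (inner ℝ · (E.mul c z)) (E.idempotent_cubic hc z)
    simp only [inner_smul_left, inner_sub_left, E.inner_mul, conj_trivial] at h3 h4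
    simp only [← real_inner_self_eq_norm_sq, inner_sub_left, inner_sub_right, inner_smul_left,
      inner_smul_right, E.inner_mul, conj_trivial]
    linarith
  rw [h]
  positivity

theorem idempotent_inner_nonneg (E : EuclideanJordanAlgebra J) {c d : J} (hc : E.mul c c = c)
    (hd : E.mul d d = d) : 0 ≤ inner ℝ c d := by
  have h := E.idempotent_inner_mul_nonneg hc d
  rwa [E.inner_mul_left, hd] at h

/-- Since ⟨c, d⟩ = ⟨c ∘ d, d⟩, both squares in the positivity certificate vanish, and their bases
combine to c ∘ d. -/
theorem idempotent_mul_eq_zero (E : EuclideanJordanAlgebra J) {c d : J} (hc : E.mul c c = c)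
    (hd : E.mul d d = d) (h : inner ℝ c d = 0) : E.mul c d = 0 := by
  have h1 := E.idempotent_inner_mul_eq hc d
  rw [E.inner_mul_left, hd, h] at h1
  have h2 : ‖(2 : ℝ) • E.mul c (E.mul c d) - E.mul c d‖ ^ 2 = 0 := by
    nlinarith [sq_nonneg ‖(2 : ℝ) • E.mul c (E.mul c d) - E.mul c d‖,
      sq_nonneg ‖E.mul c d - E.mul c (E.mul c d)‖]
  have h3 : ‖E.mul c d - E.mul c (E.mul c d)‖ ^ 2 = 0 := by
    nlinarith [sq_nonneg ‖(2 : ℝ) • E.mul c (E.mul c d) - E.mul c d‖,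
      sq_nonneg ‖E.mul c d - E.mul c (E.mul c d)‖]
  rw [sq_eq_zero_iff, norm_eq_zero] at h2 h3
  linear_combination (norm := module) (1 : ℝ) • h2 + (2 : ℝ) • h3

theorem inner_one_of_idempotent (E : EuclideanJordanAlgebra J) {c : J} (hc : E.mul c c = c) :
    inner ℝ c E.one = ‖c‖ ^ 2 := by
  rw [← real_inner_self_eq_norm_sq]
  nth_rewrite 1 [← hc]
  rw [E.inner_mul, E.mul_one]

theorem inner_eq_zero_of_mul_eq_zero (E : EuclideanJordanAlgebra J) {c d : J}
    (hd : E.mul d d = d) (h : E.mul c d = 0) : inner ℝ c d = 0 := by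
  rw [← hd, ← E.inner_mul_left, h, inner_zero_left]

theorem commute_mul_of_orthogonal_idempotents (E : EuclideanJordanAlgebra J) {c d : J}
    (hc : E.mul c c = c) (h : E.mul c d = 0) (z : J) :
    E.mul c (E.mul d z) = E.mul d (E.mul c z) := by
  have h1 := E.jordan_linearized d c c z
  rw [E.mul_comm d c, h, hc] at h1
  simpa using h1

/-- Multiplications by orthogonal idempotents commute, and a product of commuting positive operators
is positive. -/
theorem inner_mul_mul_nonneg_of_orthogonal_idempotents (E : EuclideanJordanAlgebra J) {c d : J}
    (hc : E.mul c c = c) (hd : E.mul d d = d) (h : E.mul c d = 0) (z : J) :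
    0 ≤ inner ℝ (E.mul c (E.mul d z)) z := by
  have hcomm := E.commute_mul_of_orthogonal_idempotents hc h
  rw [E.idempotent_inner_mul_eq_add hc, hcomm z, hcomm (E.mul c z), ← map_smul, ← map_sub,
    ← map_sub]
  have h1 := E.idempotent_inner_mul_nonneg hd ((2 : ℝ) • E.mul c (E.mul c z) - E.mul c z)
  have h2 := E.idempotent_inner_mul_nonneg hd (E.mul c z - E.mul c (E.mul c z))
  linarith

end EuclideanJordanAlgebra

/-! ### Primitive idempotents and the spectral theorem -/

namespace EuclideanJordanAlgebra

variable {J : Type*} [NormedAddCommGroup J] [InnerProductSpace ℝ J]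

/-- A spectral idempotent c of `y` with nonzero eigenvalue satisfies v ∘ c = c, because L_y takes
the same value `y` at `v` and at the identity element. Then v = c + (v − c) splits `v` into
idempotents, so primitivity leaves c = 0 or c = v. -/
theorem IsPrimitiveIdempotent.exists_smul_eq [FiniteDimensional ℝ J] {E : EuclideanJordanAlgebra J}
    {v : J} (hv : E.IsPrimitiveIdempotent v) {y : J} (hy : E.mul v y = y) :
    ∃ t : ℝ, t • v = y := by
  obtain ⟨-, hvv, hprim⟩ := hv
  obtain ⟨Λ, p, hmul, -, hsum, hX⟩ := E.exists_polynomial_idempotents y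
  have hcomm : Commute (E.mul y) (E.mul v) := by
    ext z
    have h := E.jordan_linearized y v v z
    rw [E.mul_comm y v, hy, hvv] at h
    simp only [Module.End.mul_apply]
    linear_combination (norm := module) (1 : ℝ) • h
  rw [← Submodule.mem_span_singleton, hsum]
  refine Submodule.sum_mem _ fun a ha => ?_
  by_cases ha0 : a = 0
  · simp [ha0]
  refine Submodule.smul_mem _ _ ?_
  have hid : E.mul (E.polyEval y (p a)) (E.polyEval y (p a)) = E.polyEval y (p a) := by
    rw [hmul a ha a ha, if_pos rfl]
  have hc : E.mul v (E.polyEval y (p a)) = E.polyEval y (p a) := by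
    have h1 := LinearMap.congr_fun (commute_aeval hcomm (p a)) E.one
    have h2 := LinearMap.congr_fun (hX a ha) v
    have h3 := LinearMap.congr_fun (hX a ha) E.one
    simp only [map_mul, Polynomial.aeval_X, Module.End.mul_apply, LinearMap.smul_apply,
      E.mul_one] at h1 h2 h3
    rw [E.mul_comm y v, hy, h3] at h2
    have h4 := smul_right_injective J ha0 h2
    rw [polyEval, ← h1]
    exact h4.symm
  rcases hprim _ (v - E.polyEval y (p a)) hid (by
    simp only [map_sub, LinearMap.sub_apply, hid, hc, hvv, E.mul_comm (E.polyEval y (p a)) v]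
    abel) (by abel) with h | h
  · rw [h]; exact Submodule.zero_mem _
  · rw [← sub_eq_zero.mp h]; exact Submodule.mem_span_singleton_self v

/-- Primitive idempotents that are not orthogonal have the same norm. -/
theorem IsPrimitiveIdempotent.norm_sq_eq [FiniteDimensional ℝ J] {E : EuclideanJordanAlgebra J}
    {u v : J} (hu : E.IsPrimitiveIdempotent u) (hv : E.IsPrimitiveIdempotent v)
    (huv : inner ℝ u v ≠ 0) : ‖u‖ ^ 2 = ‖v‖ ^ 2 := by
  -- Projecting `v` onto the eigenvalue-1 space of `u` gives t • u. The second equation is symmetric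
  -- in `u` and `v`, so exchanging them yields the same t, and the first equation then compares the
  -- norms.
  have key : ∀ u v : J, E.IsPrimitiveIdempotent u → E.IsPrimitiveIdempotent v →
      ∃ t : ℝ, t * ‖u‖ ^ 2 = inner ℝ u v ∧
        t * inner ℝ u v = 2 * ‖E.mul u v‖ ^ 2 - inner ℝ u v := by
    intro u v hu hv
    obtain ⟨t, ht⟩ := hu.exists_smul_eq (y := (2 : ℝ) • E.mul u (E.mul u v) - E.mul u v) (by
      have h := E.idempotent_cubic hu.2.1 v
      rw [map_sub, map_smul, h]
      module)
    refine ⟨t, ?_, ?_⟩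
    · have h := congrArg (inner ℝ u ·) ht
      simp only [inner_smul_right, inner_sub_right, ← E.inner_mul, hu.2.1,
        real_inner_self_eq_norm_sq] at h
      linarith
    · have h := congrArg (inner ℝ · v) ht
      simp only [inner_smul_left, inner_sub_left, E.inner_mul, conj_trivial] at h
      have h1 : inner ℝ (E.mul u v) v = inner ℝ u v := by
        rw [E.inner_mul_left, hv.2.1]
      have h2 : inner ℝ v (E.mul u v) = inner ℝ u v := by rw [real_inner_comm, h1]
      have h3 : inner ℝ v (E.mul u (E.mul u v)) = ‖E.mul u v‖ ^ 2 := by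
        rw [← E.inner_mul, real_inner_self_eq_norm_sq]
      rw [h2, h3] at h
      exact h
  obtain ⟨t, h1, h2⟩ := key u v hu hv
  obtain ⟨s, h3, h4⟩ := key v u hv hu
  rw [real_inner_comm] at h3 h4
  rw [E.mul_comm v u, ← h2] at h4
  have hts := mul_right_cancel₀ huv h4
  rw [hts, ← h1] at h3
  have ht : t ≠ 0 := by
    rintro rfl
    simp at h1
    exact huv h1.symm
  exact (mul_left_cancel₀ ht h3).symm

/-- `S` is a complete system of orthogonal nonzero idempotents and `x` is their linear combination
with coefficients `ev`. -/
structure IsSpectralSystem (E : EuclideanJordanAlgebra J) (S : Finset J) (ev : J → ℝ) (x : J) :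
    Prop where
  ne_zero : ∀ c ∈ S, c ≠ 0
  idempotent : ∀ c ∈ S, E.mul c c = c
  orthogonal : ∀ c ∈ S, ∀ d ∈ S, c ≠ d → E.mul c d = 0
  sum_eq_one : ∑ c ∈ S, c = E.one
  eq_sum : x = ∑ c ∈ S, ev c • c

theorem exists_isSpectralSystem [FiniteDimensional ℝ J] (E : EuclideanJordanAlgebra J) (x : J) :
    ∃ S ev, E.IsSpectralSystem S ev x := by
  classical
  obtain ⟨Λ, p, hmul, hone, hsum, -⟩ := E.exists_polynomial_idempotents x
  set c : ℝ → J := fun a => E.polyEval x (p a) with hc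
  set Λ' := Λ.filter fun a => c a ≠ 0 with hΛ'
  have hmem : ∀ a ∈ Λ', a ∈ Λ ∧ c a ≠ 0 := fun a ha => Finset.mem_filter.mp ha
  have hinj : Set.InjOn c Λ' := by
    intro a ha b hb hab
    by_contra hne
    have h1 := hmul a (hmem a ha).1 b (hmem b hb).1
    rw [if_neg hne] at h1
    have h2 := hmul a (hmem a ha).1 a (hmem a ha).1
    rw [if_pos rfl] at h2
    change E.mul (c a) (c b) = 0 at h1
    change E.mul (c a) (c a) = c a at h2
    rw [← hab, h2] at h1
    exact (hmem a ha).2 h1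
  have hleft : ∀ a ∈ Λ', Function.invFunOn c Λ' (c a) = a := fun a ha =>
    hinj.leftInvOn_invFunOn ha
  refine ⟨Λ'.image c, Function.invFunOn c Λ', ?_, ?_, ?_, ?_, ?_⟩
  · simp only [Finset.mem_image]
    rintro _ ⟨a, ha, rfl⟩
    exact (hmem a ha).2
  · simp only [Finset.mem_image]
    rintro _ ⟨a, ha, rfl⟩
    simpa using hmul a (hmem a ha).1 a (hmem a ha).1
  · simp only [Finset.mem_image]
    rintro _ ⟨a, ha, rfl⟩ _ ⟨b, hb, rfl⟩ hab
    have := hmul a (hmem a ha).1 b (hmem b hb).1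
    rwa [if_neg (fun h => hab (by rw [h]))] at this
  · rw [Finset.sum_image hinj, hΛ', Finset.sum_filter_ne_zero]
    exact hone
  · rw [Finset.sum_image hinj, Finset.sum_congr rfl fun a ha => by rw [hleft a ha], hsum]
    symm
    refine Finset.sum_subset (Finset.filter_subset _ _) fun a ha ha' => ?_
    have h0 : c a = 0 := by
      by_contra h
      exact ha' (Finset.mem_filter.mpr ⟨ha, h⟩)
    change a • c a = 0
    rw [h0, smul_zero]

theorem IsSpectralSystem.card_le [FiniteDimensional ℝ J] {E : EuclideanJordanAlgebra J}
    {S : Finset J} {ev : J → ℝ} {x : J} (h : E.IsSpectralSystem S ev x) :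
    S.card ≤ Module.finrank ℝ J := by
  have hli : LinearIndependent ℝ (fun c : S => (c : J)) := by
    refine linearIndependent_of_ne_zero_of_inner_eq_zero (𝕜 := ℝ) (fun c => h.ne_zero c c.2) ?_
    intro c d hcd
    exact E.inner_eq_zero_of_mul_eq_zero (h.idempotent d d.2)
      (h.orthogonal c c.2 d d.2 fun h => hcd (Subtype.ext h))
  simpa using hli.fintype_card_le_finrank

/-- Split c = p + q. Any other member d has 0 = ⟨c, d⟩ = ⟨p, d⟩ + ⟨q, d⟩ with nonnegative terms, so
both parts are orthogonal to d; both inherit the eigenvalue of c. -/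
theorem IsSpectralSystem.exists_card_succ {E : EuclideanJordanAlgebra J}
    {S : Finset J} {ev : J → ℝ} {x : J} (h : E.IsSpectralSystem S ev x) {c : J} (hc : c ∈ S)
    (hprim : ¬ E.IsPrimitiveIdempotent c) :
    ∃ S' ev', S'.card = S.card + 1 ∧ E.IsSpectralSystem S' ev' x := by
  classical
  have hcc := h.idempotent c hc
  simp only [IsPrimitiveIdempotent, not_and, not_forall, not_or] at hprim
  obtain ⟨p, q, hp, hq, hpq, hp0, hq0⟩ := hprim (h.ne_zero c hc) hcc
  have hpq0 : E.mul p q = 0 := by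
    rw [← hpq] at hcc
    simp only [map_add, LinearMap.add_apply, hp, hq, E.mul_comm q p] at hcc
    have h2 : (2 : ℝ) • E.mul p q = 0 := by linear_combination (norm := module) (1 : ℝ) • hcc
    simpa using h2
  have hpc : E.mul p c = p := by rw [← hpq, map_add, hp, hpq0, add_zero]
  have hqc : E.mul q c = q := by rw [← hpq, map_add, hq, E.mul_comm, hpq0, zero_add]
  have horth : ∀ d ∈ S.erase c, E.mul p d = 0 ∧ E.mul q d = 0 := by
    intro d hd
    have hdS := Finset.mem_of_mem_erase hd
    have hdd := h.idempotent d hdS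
    have h0 : inner ℝ c d = 0 := E.inner_eq_zero_of_mul_eq_zero hdd
      (h.orthogonal c hc d hdS (Finset.ne_of_mem_erase hd).symm)
    rw [← hpq, inner_add_left] at h0
    have h1 := E.idempotent_inner_nonneg hp hdd
    have h2 := E.idempotent_inner_nonneg hq hdd
    exact ⟨E.idempotent_mul_eq_zero hp hdd (by linarith),
      E.idempotent_mul_eq_zero hq hdd (by linarith)⟩
  have hpq_ne : p ≠ q := by
    rintro rfl
    exact hp0 (hp ▸ hpq0)
  have hqS : q ∉ S.erase c := fun hm => hq0 (by have := (horth q hm).2; rwa [hq] at this)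
  have hpS : p ∉ insert q (S.erase c) := by
    rw [Finset.mem_insert, not_or]
    exact ⟨hpq_ne, fun hm => hp0 (by have := (horth p hm).1; rwa [hp] at this)⟩
  have hne : ∀ d ∈ S.erase c, d ≠ p ∧ d ≠ q := fun d hd =>
    ⟨fun h' => hpS (Finset.mem_insert_of_mem (h' ▸ hd)), fun h' => hqS (h' ▸ hd)⟩
  refine ⟨insert p (insert q (S.erase c)),
    fun d => if d = p ∨ d = q then ev c else ev d, ?_, ?_, ?_, ?_, ?_, ?_⟩
  · rw [Finset.card_insert_of_notMem hpS, Finset.card_insert_of_notMem hqS,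
      Finset.card_erase_add_one hc]
  · simp only [Finset.mem_insert]
    rintro d (rfl | rfl | hd)
    exacts [hp0, hq0, h.ne_zero d (Finset.mem_of_mem_erase hd)]
  · simp only [Finset.mem_insert]
    rintro d (rfl | rfl | hd)
    exacts [hp, hq, h.idempotent d (Finset.mem_of_mem_erase hd)]
  · simp only [Finset.mem_insert]
    rintro d (rfl | rfl | hd) f (rfl | rfl | hf) hdf
    · exact absurd rfl hdf
    · exact hpq0
    · exact (horth f hf).1
    · rw [E.mul_comm, hpq0]
    · exact absurd rfl hdf
    · exact (horth f hf).2
    · rw [E.mul_comm, (horth d hd).1]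
    · rw [E.mul_comm, (horth d hd).2]
    · exact h.orthogonal d (Finset.mem_of_mem_erase hd) f (Finset.mem_of_mem_erase hf) hdf
  · rw [Finset.sum_insert hpS, Finset.sum_insert hqS, ← add_assoc, hpq,
      Finset.add_sum_erase S (fun d => d) hc, h.sum_eq_one]
  · rw [Finset.sum_insert hpS, Finset.sum_insert hqS, if_pos (Or.inl rfl), if_pos (Or.inr rfl),
      ← add_assoc, ← smul_add, hpq, Finset.sum_congr rfl fun d hd => by
        rw [if_neg (not_or.mpr (hne d hd))],
      Finset.add_sum_erase S (fun d => ev d • d) hc, h.eq_sum]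

/-- The spectral theorem: every element is a linear combination of a Jordan frame. -/
theorem exists_isJordanFrame [FiniteDimensional ℝ J] (E : EuclideanJordanAlgebra J) (x : J) :
    ∃ (r : ℕ) (v : Fin r → J) (ev : Fin r → ℝ), E.IsJordanFrame v ∧ x = ∑ i, ev i • v i := by
  classical
  -- Cardinalities are bounded by the dimension; a system of maximal cardinality admits no
  -- splitting, so its members are primitive.
  set N : Set ℕ := {n | ∃ S ev, S.card = n ∧ E.IsSpectralSystem S ev x} with hN
  have hne : N.Nonempty := by
    obtain ⟨S, ev, h⟩ := E.exists_isSpectralSystem x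
    exact ⟨_, S, ev, rfl, h⟩
  have hbdd : BddAbove N := by
    refine ⟨Module.finrank ℝ J, ?_⟩
    rintro _ ⟨S, ev, rfl, h⟩
    exact h.card_le
  obtain ⟨S, ev, hcard, h⟩ := Nat.sSup_mem hne hbdd
  have hprim : ∀ c ∈ S, E.IsPrimitiveIdempotent c := by
    intro c hc
    by_contra hcon
    obtain ⟨S', ev', hcard', h'⟩ := h.exists_card_succ hc hcon
    have : S'.card ≤ sSup N := le_csSup hbdd ⟨S', ev', rfl, h'⟩
    omega
  have hsum : ∀ f : J → J, ∑ i, f (S.equivFin.symm i : J) = ∑ c ∈ S, f c := fun f => by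
    rw [Equiv.sum_comp S.equivFin.symm fun c : S => f c, Finset.sum_coe_sort S f]
  refine ⟨S.card, fun i => (S.equivFin.symm i : J), fun i => ev (S.equivFin.symm i : J),
    ⟨fun i => hprim _ (S.equivFin.symm i).2, fun i j hij => ?_, ?_⟩, ?_⟩
  · exact h.orthogonal _ (S.equivFin.symm i).2 _ (S.equivFin.symm j).2 fun h' =>
      hij (S.equivFin.symm.injective (Subtype.ext h'))
  · rw [hsum fun c => c, h.sum_eq_one]
  · rw [hsum fun c => ev c • c, ← h.eq_sum]

end EuclideanJordanAlgebra

/-! ### Jordan frames, the inverse and Klein's inequality -/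

namespace EuclideanJordanAlgebra

variable {J : Type*} [NormedAddCommGroup J] [InnerProductSpace ℝ J]

/-! ### Jordan frames -/

section Frame

variable {E : EuclideanJordanAlgebra J} {r : ℕ} {v : Fin r → J}

theorem IsPrimitiveIdempotent.norm_sq_pos {v : J} (hv : E.IsPrimitiveIdempotent v) :
    0 < ‖v‖ ^ 2 := by
  have := norm_pos_iff.mpr hv.1
  positivity

theorem IsJordanFrame.inner_eq_zero (hv : E.IsJordanFrame v) {i j : Fin r} (hij : i ≠ j) :
    inner ℝ (v i) (v j) = 0 :=
  E.inner_eq_zero_of_mul_eq_zero (hv.1 j).2.1 (hv.2.1 i j hij)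

theorem IsJordanFrame.inner_sum_smul (hv : E.IsJordanFrame v) (ev : Fin r → ℝ) (i : Fin r) :
    inner ℝ (∑ j, ev j • v j) (v i) = ev i * ‖v i‖ ^ 2 := by
  rw [sum_inner, Finset.sum_eq_single i]
  · rw [inner_smul_left, real_inner_self_eq_norm_sq, conj_trivial]
  · intro j _ hj
    rw [inner_smul_left, hv.inner_eq_zero hj, mul_zero]
  · simp

theorem IsJordanFrame.mul_sum_smul (hv : E.IsJordanFrame v) (ev fv : Fin r → ℝ) :
    E.mul (∑ i, ev i • v i) (∑ i, fv i • v i) = ∑ i, (ev i * fv i) • v i := by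
  simp only [map_sum, LinearMap.sum_apply, map_smul, LinearMap.smul_apply]
  refine Finset.sum_congr rfl fun i _ => ?_
  rw [Finset.sum_eq_single i]
  · rw [(hv.1 i).2.1, smul_smul, _root_.mul_comm]
  · intro j _ hj
    rw [hv.2.1 j i hj, smul_zero]
  · simp

theorem IsJordanFrame.card_le [FiniteDimensional ℝ J] (hv : E.IsJordanFrame v) :
    r ≤ Module.finrank ℝ J := by
  have hli : LinearIndependent ℝ v :=
    linearIndependent_of_ne_zero_of_inner_eq_zero (𝕜 := ℝ) (fun i => (hv.1 i).1)
      fun i j hij => hv.inner_eq_zero hij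
  simpa using hli.fintype_card_le_finrank

theorem IsJordanFrame.sum_inner_left (hv : E.IsJordanFrame v) {c : J} (hc : E.mul c c = c) :
    ∑ i, inner ℝ (v i) c = ‖c‖ ^ 2 := by
  rw [← sum_inner, hv.2.2, real_inner_comm, E.inner_one_of_idempotent hc]

theorem IsJordanFrame.le_inner_of_le {r : ℕ} {v : Fin r → J} (hv : E.IsJordanFrame v)
    {ev : Fin r → ℝ} {ε : ℝ} (h : ∀ i, ε ≤ ev i) {c : J} (hc : E.mul c c = c) :
    ε * ‖c‖ ^ 2 ≤ inner ℝ (∑ i, ev i • v i) c := by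
  rw [← hv.sum_inner_left hc, sum_inner, Finset.mul_sum]
  refine Finset.sum_le_sum fun i _ => ?_
  rw [inner_smul_left, conj_trivial]
  exact mul_le_mul_of_nonneg_right (h i) (E.idempotent_inner_nonneg (hv.1 i).2.1 hc)

end Frame

/-! ### The trace weights -/

theorem span_primitive_eq_top [FiniteDimensional ℝ J] (E : EuclideanJordanAlgebra J) :
    ⊤ ≤ Submodule.span ℝ {v : J | E.IsPrimitiveIdempotent v} := by
  intro x _
  obtain ⟨r, v, ev, hv, rfl⟩ := E.exists_isJordanFrame x
  exact Submodule.sum_mem _ fun i _ => Submodule.smul_mem _ _ (Submodule.subset_span (hv.1 i))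

/-- There is a linear map that rescales each primitive idempotent by the inverse of its squared
norm; composed with the inner product it gives the trace form. -/
theorem exists_traceWeight [FiniteDimensional ℝ J] (E : EuclideanJordanAlgebra J) :
    ∃ D : J →L[ℝ] J, ∀ v, E.IsPrimitiveIdempotent v → D v = (‖v‖ ^ 2)⁻¹ • v := by
  set B := Module.Basis.ofSpan E.span_primitive_eq_top with hB
  have hBp : ∀ i, E.IsPrimitiveIdempotent (B i) := fun i =>
    Module.Basis.ofSpan_subset E.span_primitive_eq_top (Set.mem_range_self i)
  set D : J →ₗ[ℝ] J := B.constr ℝ fun i => (‖B i‖ ^ 2)⁻¹ • B i with hD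
  have hinner : ∀ u v, E.IsPrimitiveIdempotent u → E.IsPrimitiveIdempotent v →
      (‖u‖ ^ 2)⁻¹ * inner ℝ u v = (‖v‖ ^ 2)⁻¹ * inner ℝ u v := by
    intro u v hu hv
    by_cases h : inner ℝ u v = 0
    · simp [h]
    · rw [hu.norm_sq_eq hv h]
  -- `D` is prescribed only on one basis of primitive idempotents. Testing against an arbitrary
  -- primitive w, where nonorthogonal pairs share their norm, shows that the choice does not matter.
  have key : ∀ w, E.IsPrimitiveIdempotent w → ∀ x,
      inner ℝ w (D x) = (‖w‖ ^ 2)⁻¹ * inner ℝ w x := by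
    intro w hw x
    have : (innerₛₗ ℝ w) ∘ₗ D = (‖w‖ ^ 2)⁻¹ • innerₛₗ ℝ w := by
      refine B.ext fun i => ?_
      simp only [LinearMap.comp_apply, hD, Module.Basis.constr_basis, LinearMap.smul_apply,
        innerₛₗ_apply_apply, inner_smul_right, smul_eq_mul]
      exact (real_inner_comm (B i) w ▸ hinner (B i) w (hBp i) hw)
    simpa using LinearMap.congr_fun this x
  refine ⟨LinearMap.toContinuousLinearMap D, fun v hv => ?_⟩
  rw [LinearMap.coe_toContinuousLinearMap']
  have : innerₛₗ ℝ (D v) = innerₛₗ ℝ ((‖v‖ ^ 2)⁻¹ • v) := by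
    refine LinearMap.ext_on (top_le_iff.mp E.span_primitive_eq_top) fun w hw => ?_
    simp only [innerₛₗ_apply_apply, inner_smul_left, conj_trivial]
    rw [real_inner_comm, key w hw, real_inner_comm v w]
    exact (real_inner_comm w v ▸ hinner w v hw hv)
  refine ext_inner_right ℝ fun w => ?_
  exact LinearMap.congr_fun this w

/-- A linear map that rescales each primitive idempotent by the inverse of its squared norm. -/
noncomputable def traceWeight [FiniteDimensional ℝ J] (E : EuclideanJordanAlgebra J) : J →L[ℝ] J :=
  Classical.choose E.exists_traceWeight

theorem traceWeight_apply [FiniteDimensional ℝ J] (E : EuclideanJordanAlgebra J) {v : J}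
    (hv : E.IsPrimitiveIdempotent v) : E.traceWeight v = (‖v‖ ^ 2)⁻¹ • v :=
  Classical.choose_spec E.exists_traceWeight v hv

/-! ### The quadratic representation and the inverse -/

/-- The multiplication as a continuous bilinear map. -/
noncomputable def mulCLM [FiniteDimensional ℝ J] (E : EuclideanJordanAlgebra J) :
    J →L[ℝ] J →L[ℝ] J :=
  LinearMap.toContinuousLinearMap
    ((LinearMap.toContinuousLinearMap : (J →ₗ[ℝ] J) ≃ₗ[ℝ] J →L[ℝ] J).toLinearMap ∘ₗ E.mul)

@[simp]
theorem mulCLM_apply [FiniteDimensional ℝ J] (E : EuclideanJordanAlgebra J) (x y : J) :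
    E.mulCLM x y = E.mul x y := rfl

/-- The quadratic representation. -/
noncomputable def quad [FiniteDimensional ℝ J] (E : EuclideanJordanAlgebra J) (x : J) :
    J →L[ℝ] J :=
  (2 : ℝ) • (E.mulCLM x).comp (E.mulCLM x) - E.mulCLM (E.mulCLM x x)

theorem quad_apply [FiniteDimensional ℝ J] (E : EuclideanJordanAlgebra J) (x z : J) :
    E.quad x z = (2 : ℝ) • E.mul x (E.mul x z) - E.mul (E.mul x x) z := rfl

theorem contDiff_quad [FiniteDimensional ℝ J] (E : EuclideanJordanAlgebra J) {n : WithTop ℕ∞} :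
    ContDiff ℝ n E.quad := by
  unfold quad
  have h1 : ContDiff ℝ n fun x => E.mulCLM x := E.mulCLM.contDiff
  exact ((h1.clm_comp h1).const_smul (2 : ℝ)).sub
    (E.mulCLM.contDiff.comp (h1.clm_apply contDiff_id))

theorem inner_quad_sum [FiniteDimensional ℝ J] (E : EuclideanJordanAlgebra J) {r : ℕ}
    (v : Fin r → J) (ev : Fin r → ℝ) (z : J) :
    inner ℝ (E.quad (∑ i, ev i • v i) z) z = ∑ i, ∑ j, ev i * ev j *
      inner ℝ ((2 : ℝ) • E.mul (v i) (E.mul (v j) z) - E.mul (E.mul (v i) (v j)) z) z := by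
  rw [quad_apply]
  simp only [map_sum, LinearMap.sum_apply, map_smul, LinearMap.smul_apply, Finset.smul_sum,
    inner_sub_left, sum_inner, inner_smul_left, conj_trivial, mul_sub, Finset.sum_sub_distrib]
  congr 1
  · rw [Finset.sum_comm]
    refine Finset.sum_congr rfl fun i _ => Finset.sum_congr rfl fun j _ => ?_
    ring
  · rw [Finset.sum_comm]
    refine Finset.sum_congr rfl fun i _ => Finset.sum_congr rfl fun j _ => ?_
    ring

/-- The form ⟨Q(x)z, z⟩ is a sum of nonnegative quantities, free of the eigenvalues, with positive
coefficients `ev i * ev j`. If it vanishes, so does the sum with all coefficients 1, which is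
⟨Q(e)z, z⟩ = ‖z‖². -/
theorem isUnit_quad [FiniteDimensional ℝ J] {E : EuclideanJordanAlgebra J} {r : ℕ}
    {v : Fin r → J} (hv : E.IsJordanFrame v) {ev : Fin r → ℝ} (hev : ∀ i, 0 < ev i) :
    IsUnit (E.quad (∑ i, ev i • v i)) := by
  have hinj : Function.Injective (E.quad (∑ i, ev i • v i)) := by
    rw [injective_iff_map_eq_zero]
    intro z hz
    have hnn : ∀ i j, 0 ≤ inner ℝ
        ((2 : ℝ) • E.mul (v i) (E.mul (v j) z) - E.mul (E.mul (v i) (v j)) z) z := by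
      intro i j
      by_cases hij : i = j
      · subst hij
        rw [(hv.1 i).2.1]
        exact E.idempotent_two_mul_sub_nonneg (hv.1 i).2.1 z
      · rw [hv.2.1 i j hij, map_zero, LinearMap.zero_apply, sub_zero, inner_smul_left]
        have := E.inner_mul_mul_nonneg_of_orthogonal_idempotents (hv.1 i).2.1 (hv.1 j).2.1
          (hv.2.1 i j hij) z
        simp only [conj_trivial]
        positivity
    have h1 := E.inner_quad_sum v ev z
    rw [hz, inner_zero_left] at h1
    have hterm : ∀ i j, 0 ≤ ev i * ev j * inner ℝ
        ((2 : ℝ) • E.mul (v i) (E.mul (v j) z) - E.mul (E.mul (v i) (v j)) z) z :=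
      fun i j => mul_nonneg (mul_pos (hev i) (hev j)).le (hnn i j)
    have h2 := E.inner_quad_sum v (fun _ => 1) z
    simp only [one_smul, hv.2.2] at h2
    rw [quad_apply, E.one_mul, E.one_mul, E.one_mul, E.one_mul, two_smul, add_sub_cancel_right,
      Finset.sum_eq_zero fun i _ => Finset.sum_eq_zero fun j _ => ?_] at h2
    · simpa using h2
    have h3 := (Finset.sum_eq_zero_iff_of_nonneg fun i _ =>
      Finset.sum_nonneg fun j _ => hterm i j).mp h1.symm i (Finset.mem_univ i)
    have h4 := (Finset.sum_eq_zero_iff_of_nonneg fun j _ => hterm i j).mp h3 j (Finset.mem_univ j)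
    have h5 := (mul_eq_zero.mp h4).resolve_left (mul_pos (hev i) (hev j)).ne'
    rw [h5, mul_zero]
  rw [ContinuousLinearMap.isUnit_iff_bijective]
  exact ⟨hinj, (LinearMap.injective_iff_surjective (f := (E.quad (∑ i, ev i • v i)).toLinearMap)).mp
    hinj⟩

/-- The gradient of the barrier on the interior of the cone. -/
noncomputable def barrierGrad [FiniteDimensional ℝ J] (E : EuclideanJordanAlgebra J) (x : J) : J :=
  -E.traceWeight (Ring.inverse (E.quad x) x)

theorem barrierGrad_sum [FiniteDimensional ℝ J] {E : EuclideanJordanAlgebra J} {r : ℕ}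
    {v : Fin r → J} (hv : E.IsJordanFrame v) {ev : Fin r → ℝ} (hev : ∀ i, 0 < ev i) :
    E.barrierGrad (∑ i, ev i • v i) = -∑ i, ((ev i)⁻¹ * (‖v i‖ ^ 2)⁻¹) • v i := by
  have hu := isUnit_quad hv hev
  have h1 : E.quad (∑ i, ev i • v i) (∑ i, (ev i)⁻¹ • v i) = ∑ i, ev i • v i := by
    rw [quad_apply, hv.mul_sum_smul, hv.mul_sum_smul, hv.mul_sum_smul, hv.mul_sum_smul,
      Finset.smul_sum, ← Finset.sum_sub_distrib]
    refine Finset.sum_congr rfl fun i _ => ?_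
    rw [smul_smul, ← sub_smul]
    congr 1
    have := (hev i).ne'
    field_simp
    ring
  have h2 : Ring.inverse (E.quad (∑ i, ev i • v i)) (∑ i, ev i • v i)
      = ∑ i, (ev i)⁻¹ • v i := by
    conv_lhs => enter [2]; rw [← h1]
    rw [← mul_apply_eq_comp, Ring.inverse_mul_cancel _ hu]
    rfl
  rw [barrierGrad, h2, map_sum]
  congr 1
  refine Finset.sum_congr rfl fun i _ => ?_
  rw [map_smul, E.traceWeight_apply (hv.1 i), smul_smul]

theorem contDiffAt_barrierGrad [FiniteDimensional ℝ J] [CompleteSpace J]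
    {E : EuclideanJordanAlgebra J} {x : J}
    (hx : IsUnit (E.quad x)) {n : WithTop ℕ∞} : ContDiffAt ℝ n E.barrierGrad x := by
  obtain ⟨u, hu⟩ := hx
  have h1 : ContDiffAt ℝ n (fun y => Ring.inverse (E.quad y)) x := by
    have := contDiffAt_ringInverse ℝ u (n := n)
    rw [hu] at this
    exact this.comp x E.contDiff_quad.contDiffAt
  exact (E.traceWeight.contDiff.contDiffAt.comp x (h1.clm_apply contDiffAt_id)).neg

/-! ### Klein's inequality -/

/-- Source of strictness in `klein_lt`: distinct elements must have some pair of different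
eigenvalues whose idempotents are not orthogonal. -/
theorem norm_sub_sq_eq_sum {E : EuclideanJordanAlgebra J} {r k : ℕ} {v : Fin r → J}
    {w : Fin k → J} (hv : E.IsJordanFrame v) (hw : E.IsJordanFrame w) (ev : Fin r → ℝ)
    (fw : Fin k → ℝ) : ‖(∑ i, ev i • v i) - ∑ j, fw j • w j‖ ^ 2
      = ∑ i, ∑ j, (ev i - fw j) ^ 2 * inner ℝ (v i) (w j) := by
  have h1 : inner ℝ (∑ i, ev i • v i) (∑ i, ev i • v i)
      = ∑ i, ∑ j, ev i ^ 2 * inner ℝ (v i) (w j) := by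
    rw [inner_sum]
    refine Finset.sum_congr rfl fun i _ => ?_
    rw [inner_smul_right, hv.inner_sum_smul, ← Finset.mul_sum, ← inner_sum, hw.2.2,
      E.inner_one_of_idempotent (hv.1 i).2.1]
    ring
  have h2 : inner ℝ (∑ j, fw j • w j) (∑ j, fw j • w j)
      = ∑ i, ∑ j, fw j ^ 2 * inner ℝ (v i) (w j) := by
    rw [inner_sum, Finset.sum_comm]
    refine Finset.sum_congr rfl fun j _ => ?_
    rw [inner_smul_right, hw.inner_sum_smul, ← Finset.mul_sum, hv.sum_inner_left (hw.1 j).2.1]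
    ring
  have h3 : inner ℝ (∑ i, ev i • v i) (∑ j, fw j • w j)
      = ∑ i, ∑ j, ev i * fw j * inner ℝ (v i) (w j) := by
    rw [sum_inner]
    refine Finset.sum_congr rfl fun i _ => ?_
    rw [inner_sum]
    refine Finset.sum_congr rfl fun j _ => ?_
    rw [inner_smul_left, inner_smul_right, conj_trivial]
    ring
  rw [← real_inner_self_eq_norm_sq, real_inner_sub_sub_self, h1, h2, h3, Finset.mul_sum,
    ← Finset.sum_sub_distrib, ← Finset.sum_add_distrib]
  refine Finset.sum_congr rfl fun i _ => ?_
  rw [Finset.mul_sum, ← Finset.sum_sub_distrib, ← Finset.sum_add_distrib]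
  refine Finset.sum_congr rfl fun j _ => ?_
  ring

theorem klein_eq [FiniteDimensional ℝ J] {E : EuclideanJordanAlgebra J} {r k : ℕ}
    {v : Fin r → J} {w : Fin k → J} (hv : E.IsJordanFrame v) (hw : E.IsJordanFrame w)
    {ev : Fin r → ℝ} {fw : Fin k → ℝ} (hev : ∀ i, 0 < ev i) (hfw : ∀ j, 0 < fw j) :
    -(∑ j, Real.log (fw j)) + ∑ i, Real.log (ev i)
        - inner ℝ (E.barrierGrad (∑ i, ev i • v i)) ((∑ j, fw j • w j) - ∑ i, ev i • v i)
      = ∑ i, ∑ j, ((‖v i‖ ^ 2)⁻¹ * inner ℝ (v i) (w j))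
          * (fw j / ev i - 1 - Real.log (fw j / ev i)) := by
  have hvn := fun i => (hv.1 i).norm_sq_pos.ne'
  have hwn := fun j => (hw.1 j).norm_sq_pos.ne'
  have hrow : ∀ i, ∑ j, (‖v i‖ ^ 2)⁻¹ * inner ℝ (v i) (w j) = 1 := by
    intro i
    rw [← Finset.mul_sum, ← inner_sum, hw.2.2, E.inner_one_of_idempotent (hv.1 i).2.1,
      inv_mul_cancel₀ (hvn i)]
  -- Nonorthogonal pairs have equal norms, so the normalisation by `v i` may be traded for one by `w
  -- j`.
  have hcol : ∀ j, ∑ i, (‖v i‖ ^ 2)⁻¹ * inner ℝ (v i) (w j) = 1 := by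
    intro j
    have : ∀ i, (‖v i‖ ^ 2)⁻¹ * inner ℝ (v i) (w j) = (‖w j‖ ^ 2)⁻¹ * inner ℝ (v i) (w j) := by
      intro i
      by_cases h : inner ℝ (v i) (w j) = 0
      · simp [h]
      · rw [(hv.1 i).norm_sq_eq (hw.1 j) h]
    rw [Finset.sum_congr rfl fun i _ => this i, ← Finset.mul_sum,
      hv.sum_inner_left (hw.1 j).2.1, inv_mul_cancel₀ (hwn j)]
  have h1 : ∑ j, Real.log (fw j)
      = ∑ i, ∑ j, ((‖v i‖ ^ 2)⁻¹ * inner ℝ (v i) (w j)) * Real.log (fw j) := by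
    rw [Finset.sum_comm]
    refine Finset.sum_congr rfl fun j _ => ?_
    rw [← Finset.sum_mul, hcol, _root_.one_mul]
  have h2 : ∑ i, Real.log (ev i)
      = ∑ i, ∑ j, ((‖v i‖ ^ 2)⁻¹ * inner ℝ (v i) (w j)) * Real.log (ev i) := by
    refine Finset.sum_congr rfl fun i _ => ?_
    rw [← Finset.sum_mul, hrow, _root_.one_mul]
  have h3 : inner ℝ (E.barrierGrad (∑ i, ev i • v i)) ((∑ j, fw j • w j) - ∑ i, ev i • v i)
      = -∑ i, ∑ j, ((‖v i‖ ^ 2)⁻¹ * inner ℝ (v i) (w j)) * (fw j / ev i - 1) := by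
    rw [barrierGrad_sum hv hev, inner_neg_left, sum_inner]
    congr 1
    refine Finset.sum_congr rfl fun i _ => ?_
    rw [inner_smul_left, inner_sub_right, real_inner_comm (∑ i, ev i • v i), hv.inner_sum_smul,
      inner_sum]
    simp only [mul_sub, Finset.sum_sub_distrib, _root_.mul_one, hrow, conj_trivial,
      Finset.mul_sum, inner_smul_right]
    have := (hev i).ne'
    have := hvn i
    congr 1
    · refine Finset.sum_congr rfl fun j _ => ?_
      field_simp
    · rw [mul_mul_mul_comm, inv_mul_cancel₀ (hev i).ne', inv_mul_cancel₀ (hvn i),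
        _root_.one_mul]
  rw [h1, h2, h3, sub_neg_eq_add, ← Finset.sum_neg_distrib, ← Finset.sum_add_distrib,
    ← Finset.sum_add_distrib]
  refine Finset.sum_congr rfl fun i _ => ?_
  rw [← Finset.sum_neg_distrib, ← Finset.sum_add_distrib, ← Finset.sum_add_distrib]
  refine Finset.sum_congr rfl fun j _ => ?_
  rw [Real.log_div (hfw j).ne' (hev i).ne']
  ring

theorem klein_lt [FiniteDimensional ℝ J] {E : EuclideanJordanAlgebra J} {r k : ℕ}
    {v : Fin r → J} {w : Fin k → J} (hv : E.IsJordanFrame v) (hw : E.IsJordanFrame w)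
    {ev : Fin r → ℝ} {fw : Fin k → ℝ} (hev : ∀ i, 0 < ev i) (hfw : ∀ j, 0 < fw j)
    (hne : ∑ i, ev i • v i ≠ ∑ j, fw j • w j) :
    -(∑ i, Real.log (ev i))
        + inner ℝ (E.barrierGrad (∑ i, ev i • v i)) ((∑ j, fw j • w j) - ∑ i, ev i • v i)
      < -(∑ j, Real.log (fw j)) := by
  have h := klein_eq hv hw hev hfw
  have hw0 : ∀ i j, 0 ≤ inner ℝ (v i) (w j) := fun i j =>
    E.idempotent_inner_nonneg (hv.1 i).2.1 (hw.1 j).2.1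
  have hlog : ∀ i j, 0 ≤ fw j / ev i - 1 - Real.log (fw j / ev i) := fun i j => by
    have := Real.log_le_sub_one_of_pos (div_pos (hfw j) (hev i))
    linarith
  have hterm : ∀ i j, 0 ≤ ((‖v i‖ ^ 2)⁻¹ * inner ℝ (v i) (w j))
      * (fw j / ev i - 1 - Real.log (fw j / ev i)) := fun i j =>
    mul_nonneg (mul_nonneg (by positivity) (hw0 i j)) (hlog i j)
  suffices 0 < ∑ i, ∑ j, ((‖v i‖ ^ 2)⁻¹ * inner ℝ (v i) (w j))
          * (fw j / ev i - 1 - Real.log (fw j / ev i)) by linarith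
  have hpos : 0 < ∑ i, ∑ j, (ev i - fw j) ^ 2 * inner ℝ (v i) (w j) := by
    rw [← norm_sub_sq_eq_sum hv hw]
    have := norm_pos_iff.mpr (sub_ne_zero.mpr hne)
    positivity
  obtain ⟨i, -, hi⟩ := Finset.exists_lt_of_sum_lt (s := Finset.univ) (f := fun _ => (0 : ℝ))
    (by simpa using hpos)
  obtain ⟨j, -, hj⟩ := Finset.exists_lt_of_sum_lt (s := Finset.univ) (f := fun _ => (0 : ℝ))
    (by simpa using hi)
  have hij : inner ℝ (v i) (w j) ≠ 0 := fun h0 => by simp [h0] at hj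
  have hne' : fw j / ev i ≠ 1 := fun h0 => by
    rw [div_eq_one_iff_eq (hev i).ne'] at h0
    simp [h0] at hj
  have hlt := Real.log_lt_sub_one_of_pos (div_pos (hfw j) (hev i)) hne'
  refine Finset.sum_pos' (fun i _ => Finset.sum_nonneg fun j _ => hterm i j)
    ⟨i, Finset.mem_univ i, Finset.sum_pos' (fun j _ => hterm i j) ⟨j, Finset.mem_univ j, ?_⟩⟩
  exact mul_pos (mul_pos (inv_pos.mpr (hv.1 i).norm_sq_pos) ((hw0 i j).lt_of_ne' hij))
    (by linarith)

end EuclideanJordanAlgebra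

namespace EuclideanJordanAlgebra

variable {J : Type*} [NormedAddCommGroup J] [InnerProductSpace ℝ J] [FiniteDimensional ℝ J]

/-! ### The cone -/

section Cone

variable {E : EuclideanJordanAlgebra J}

/-- Squares pair nonnegatively because L_c is positive; conversely, testing on a frame makes the
eigenvalues nonnegative and a square root exists. -/
theorem mem_cone_iff {x : J} : x ∈ E.cone ↔ ∀ c, E.mul c c = c → 0 ≤ inner ℝ x c := by
  constructor
  · rintro ⟨y, rfl⟩ c hc
    have h := E.idempotent_inner_mul_nonneg hc y
    rw [E.mul_comm c y, real_inner_comm] at h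
    rwa [E.inner_mul]
  · intro h
    obtain ⟨r, v, ev, hv, rfl⟩ := E.exists_isJordanFrame x
    have hev : ∀ i, 0 ≤ ev i := fun i => by
      have h1 := h (v i) (hv.1 i).2.1
      rw [hv.inner_sum_smul] at h1
      exact nonneg_of_mul_nonneg_left h1 (hv.1 i).norm_sq_pos
    refine ⟨∑ i, √(ev i) • v i, ?_⟩
    simp only [hv.mul_sum_smul]
    exact Finset.sum_congr rfl fun i _ => by rw [Real.mul_self_sqrt (hev i)]

/-- As ‖c‖² = ⟨e, c⟩, the bound says that x − δe lies in the cone. A perturbation h changes ⟨x, c⟩ =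
⟨L_x c, c⟩ by at most ‖L_h‖‖c‖². -/
theorem mem_interior_cone_iff {x : J} : x ∈ interior E.cone ↔
    ∃ δ > 0, ∀ c, E.mul c c = c → δ * ‖c‖ ^ 2 ≤ inner ℝ x c := by
  constructor
  · intro hx
    have hcont : ContinuousAt (fun δ : ℝ => x - δ • E.one) 0 := by fun_prop
    have h1 : ∀ᶠ δ : ℝ in 𝓝[>] 0, x - δ • E.one ∈ E.cone := by
      refine nhdsWithin_le_nhds (hcont.eventually_mem ?_)
      simpa using mem_interior_iff_mem_nhds.mp hx
    obtain ⟨δ, hδ, hpos⟩ := (h1.and self_mem_nhdsWithin).exists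
    refine ⟨δ, hpos, fun c hc => ?_⟩
    have h2 := mem_cone_iff.mp hδ c hc
    rw [inner_sub_left, inner_smul_left, real_inner_comm c E.one, E.inner_one_of_idempotent hc,
      conj_trivial] at h2
    linarith
  · rintro ⟨δ, hδ, h⟩
    rw [mem_interior_iff_mem_nhds]
    have hcont : ContinuousAt (fun y => ‖E.mulCLM (y - x)‖) x := by fun_prop
    have h1 : ∀ᶠ y in 𝓝 x, ‖E.mulCLM (y - x)‖ < δ := by
      refine hcont.eventually_lt continuousAt_const ?_
      simpa using hδ
    filter_upwards [h1] with y hy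
    refine mem_cone_iff.mpr fun c hc => ?_
    have h2 : inner ℝ (y - x) c = inner ℝ (E.mulCLM (y - x) c) c := by
      rw [mulCLM_apply, E.inner_mul_left, hc]
    have h3 := abs_le.mp (abs_real_inner_le_norm (E.mulCLM (y - x) c) c)
    have h4 := (E.mulCLM (y - x)).le_opNorm c
    have h5 : ‖E.mulCLM (y - x) c‖ * ‖c‖ ≤ δ * ‖c‖ ^ 2 := by
      calc ‖E.mulCLM (y - x) c‖ * ‖c‖ ≤ (‖E.mulCLM (y - x)‖ * ‖c‖) * ‖c‖ := by gcongr
        _ ≤ (δ * ‖c‖) * ‖c‖ := by gcongr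
        _ = δ * ‖c‖ ^ 2 := by ring
    have h6 := h c hc
    rw [inner_sub_left] at h2
    linarith

theorem one_mem_interior_cone : E.one ∈ interior E.cone := by
  refine mem_interior_cone_iff.mpr ⟨1, one_pos, fun c hc => ?_⟩
  rw [real_inner_comm, E.inner_one_of_idempotent hc, _root_.one_mul]

theorem IsJordanFrame.pos_of_mem_interior_cone {r : ℕ} {v : Fin r → J} (hv : E.IsJordanFrame v)
    {ev : Fin r → ℝ} (h : ∑ i, ev i • v i ∈ interior E.cone) (i : Fin r) : 0 < ev i := by
  obtain ⟨δ, hδ, h⟩ := mem_interior_cone_iff.mp h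
  have h1 := h (v i) (hv.1 i).2.1
  rw [hv.inner_sum_smul] at h1
  exact hδ.trans_le (le_of_mul_le_mul_right h1 (hv.1 i).norm_sq_pos)

/-! ### The barrier -/

/-- The choice operator in `det` picks an unspecified frame; this suffices, since Klein's inequality
holds for arbitrary frames. -/
theorem exists_frame_barrier_eq {x : J} (hx : x ∈ interior E.cone) :
    ∃ (r : ℕ) (v : Fin r → J) (ev : Fin r → ℝ), E.IsJordanFrame v ∧ x = ∑ i, ev i • v i ∧
      (∀ i, 0 < ev i) ∧ E.barrier x = -∑ i, Real.log (ev i) := by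
  have hex : ∃ d, E.IsDet x d := by
    obtain ⟨r, v, ev, hv, h⟩ := E.exists_isJordanFrame x
    exact ⟨_, r, v, ev, hv, h, rfl⟩
  obtain ⟨r, v, ev, hv, h, hd⟩ := Classical.epsilon_spec hex
  have hpos : ∀ i, 0 < ev i := fun i => hv.pos_of_mem_interior_cone (h ▸ hx) i
  refine ⟨r, v, ev, hv, h, hpos, ?_⟩
  rw [barrier, det, hd, Real.log_prod fun i _ => (hpos i).ne']

theorem barrier_add_inner_lt {x y : J} (hx : x ∈ interior E.cone) (hy : y ∈ interior E.cone)
    (hxy : x ≠ y) : E.barrier x + inner ℝ (E.barrierGrad x) (y - x) < E.barrier y := by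
  obtain ⟨r, v, ev, hv, hxe, hev, hbx⟩ := exists_frame_barrier_eq hx
  obtain ⟨k, w, fw, hw, hyf, hfw, hby⟩ := exists_frame_barrier_eq hy
  rw [hbx, hby, hxe, hyf]
  exact klein_lt hv hw hev hfw (by rwa [← hxe, ← hyf])

theorem contDiffAt_barrierGrad_of_mem [CompleteSpace J] {x : J} (hx : x ∈ interior E.cone)
    {n : WithTop ℕ∞} : ContDiffAt ℝ n E.barrierGrad x := by
  obtain ⟨r, v, ev, hv, rfl, hev, -⟩ := exists_frame_barrier_eq hx
  exact contDiffAt_barrierGrad (isUnit_quad hv hev)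

/-- The norm bound caps every eigenvalue by `M`, so a lower bound on the product bounds each factor
below. Taking M ≥ 1 keeps log M ≥ 0, which lets the dimension replace the number of factors. -/
theorem exists_pos_of_barrier_le (E : EuclideanJordanAlgebra J) (R C : ℝ) :
    ∃ ε > 0, ∀ y ∈ interior E.cone, ‖y‖ ≤ R → E.barrier y ≤ C →
      ∀ c, E.mul c c = c → ε * ‖c‖ ^ 2 ≤ inner ℝ y c := by
  set M := max 1 (‖E.mulCLM‖ * R) with hM
  have hM1 : 1 ≤ M := le_max_left _ _
  refine ⟨Real.exp (-(C + Module.finrank ℝ J * Real.log M)), Real.exp_pos _,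
    fun y hy hyR hyC c hc => ?_⟩
  obtain ⟨r, v, ev, hv, rfl, hev, hb⟩ := exists_frame_barrier_eq hy
  refine hv.le_inner_of_le (fun i => ?_) hc
  have hle : ∀ i, ev i ≤ M := by
    intro i
    have h1 : ev i * ‖v i‖ ^ 2 = inner ℝ (E.mulCLM (∑ i, ev i • v i) (v i)) (v i) := by
      rw [mulCLM_apply, E.inner_mul_left, (hv.1 i).2.1, hv.inner_sum_smul]
    have h2 : ev i * ‖v i‖ ^ 2 ≤ (‖E.mulCLM‖ * R) * ‖v i‖ ^ 2 := by
      rw [h1]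
      calc _ ≤ ‖E.mulCLM (∑ i, ev i • v i) (v i)‖ * ‖v i‖ := real_inner_le_norm _ _
        _ ≤ (‖E.mulCLM‖ * ‖∑ i, ev i • v i‖ * ‖v i‖) * ‖v i‖ := by
          gcongr
          exact E.mulCLM.le_opNorm₂ _ _
        _ ≤ (‖E.mulCLM‖ * R * ‖v i‖) * ‖v i‖ := by gcongr
        _ = (‖E.mulCLM‖ * R) * ‖v i‖ ^ 2 := by ring
    exact (le_of_mul_le_mul_right h2 (hv.1 i).norm_sq_pos).trans (le_max_right _ _)
  have hlogM : 0 ≤ Real.log M := Real.log_nonneg hM1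
  have hsum : ∑ j ∈ Finset.univ.erase i, Real.log (ev j)
      ≤ Module.finrank ℝ J * Real.log M := by
    calc _ ≤ ∑ j ∈ Finset.univ.erase i, Real.log M :=
          Finset.sum_le_sum fun j _ => Real.log_le_log (hev j) (hle j)
      _ ≤ ∑ j : Fin r, Real.log M :=
          Finset.sum_le_sum_of_subset_of_nonneg (Finset.erase_subset _ _) fun _ _ _ => hlogM
      _ = r * Real.log M := by simp
      _ ≤ Module.finrank ℝ J * Real.log M := by
          gcongr
          exact hv.card_le
  have hsplit := Finset.add_sum_erase Finset.univ (fun j => Real.log (ev j)) (Finset.mem_univ i)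
  rw [← Real.le_log_iff_exp_le (hev i)]
  linarith

/-- Bounded sublevel sets of the barrier lie in compact subsets of the interior of the cone. -/
theorem exists_isCompact_of_barrier_le (E : EuclideanJordanAlgebra J) (R C : ℝ) :
    ∃ K ⊆ interior E.cone, IsCompact K ∧
      ∀ y ∈ interior E.cone, ‖y‖ ≤ R → E.barrier y ≤ C → y ∈ K := by
  obtain ⟨ε, hε, h⟩ := E.exists_pos_of_barrier_le R C
  refine ⟨Metric.closedBall 0 R ∩ {y | ∀ c, E.mul c c = c → ε * ‖c‖ ^ 2 ≤ inner ℝ y c},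
    fun y hy => mem_interior_cone_iff.mpr ⟨ε, hε, hy.2⟩, ?_, fun y hy hR hC =>
      ⟨by simpa using hR, h y hy hR hC⟩⟩
  have : ProperSpace J := FiniteDimensional.proper_real J
  refine (isCompact_closedBall 0 R).inter_right ?_
  simp only [Set.ofPred_forall]
  exact isClosed_iInter fun c => isClosed_iInter fun _ =>
    isClosed_le continuous_const (by fun_prop)

end Cone

end EuclideanJordanAlgebra

/-- `g` is a selection of subgradients of `ψ` on `U`, with strict subgradient inequalities. -/
def HasStrictSubgradientOn {V : Type*} [NormedAddCommGroup V] [InnerProductSpace ℝ V] (ψ : V → ℝ)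
    (g : V → V) (U : Set V) : Prop :=
  ∀ x ∈ U, ∀ y ∈ U, x ≠ y → ψ x + inner ℝ (g x) (y - x) < ψ y

/-! ### Strict subgradients, proximal maps and Moreau envelopes -/

namespace HasStrictSubgradientOn

variable {V : Type*} [NormedAddCommGroup V] [InnerProductSpace ℝ V] {ψ : V → ℝ} {g : V → V}
  {U : Set V}

theorem le (h : HasStrictSubgradientOn ψ g U) {x y : V} (hx : x ∈ U) (hy : y ∈ U) :
    ψ x + inner ℝ (g x) (y - x) ≤ ψ y := by
  by_cases hxy : x = y
  · simp [hxy]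
  · exact (h x hx y hy hxy).le

theorem monotone (h : HasStrictSubgradientOn ψ g U) {x y : V} (hx : x ∈ U) (hy : y ∈ U) :
    0 ≤ inner ℝ (g y - g x) (y - x) := by
  have h1 := h.le hx hy
  have h2 := h.le hy hx
  rw [← neg_sub y x, inner_neg_right] at h2
  rw [inner_sub_left]
  linarith

theorem const_mul (h : HasStrictSubgradientOn ψ g U) {a : ℝ} (ha : 0 < a) :
    HasStrictSubgradientOn (fun x => a * ψ x) (fun x => a • g x) U := by
  intro x hx y hy hxy
  have := mul_lt_mul_of_pos_left (h x hx y hy hxy) ha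
  rw [inner_smul_left, conj_trivial]
  linarith

theorem strictConvexOn (h : HasStrictSubgradientOn ψ g U) (hU : Convex ℝ U) :
    StrictConvexOn ℝ U ψ := by
  refine ⟨hU, fun x hx y hy hxy a b ha hb hab => ?_⟩
  set z := a • x + b • y with hz
  have hzU : z ∈ U := hU hx hy ha.le hb.le hab
  have hzx : z - x = b • (y - x) := by
    rw [hz, eq_sub_of_add_eq hab]; module
  have hzy : z - y = a • (x - y) := by
    rw [hz, eq_sub_of_add_eq' hab]; module
  have h1 := h z hzU x hx fun h0 => by
    rw [h0, sub_self] at hzx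
    exact (smul_ne_zero hb.ne' (sub_ne_zero.mpr hxy.symm)) hzx.symm
  have h2 := h z hzU y hy fun h0 => by
    rw [h0, sub_self] at hzy
    exact (smul_ne_zero ha.ne' (sub_ne_zero.mpr hxy)) hzy.symm
  have h3 : a * inner ℝ (g z) (x - z) + b * inner ℝ (g z) (y - z) = 0 := by
    rw [← inner_smul_right, ← inner_smul_right, ← inner_add_right]
    have : a • (x - z) + b • (y - z) = (0 : V) := by
      rw [← neg_sub z x, ← neg_sub z y, hzx, hzy]; module
    rw [this, inner_zero_right]
  have h4 : ψ z = a * ψ z + b * ψ z := by rw [← add_mul, hab, one_mul]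
  simp only [smul_eq_mul]
  linarith [mul_lt_mul_of_pos_left h1 ha, mul_lt_mul_of_pos_left h2 hb]

/-- The subgradient inequalities at `x` and at y trap the linearisation error between 0 and ⟨g y − g
x, y − x⟩, which is o(‖y − x‖) by continuity of `g`. -/
theorem hasGradientAt [CompleteSpace V] (h : HasStrictSubgradientOn ψ g U) {x : V} (hx : U ∈ 𝓝 x)
    (hg : ContinuousAt g x) : HasGradientAt ψ (g x) x := by
  rw [hasGradientAt_iff_isLittleO, Asymptotics.isLittleO_iff]
  intro ε hε
  have h1 : ∀ᶠ y in 𝓝 x, ‖g y - g x‖ < ε := by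
    simpa [dist_eq_norm] using Metric.tendsto_nhds.mp hg ε hε
  filter_upwards [h1, hx] with y hy hyU
  have h2 := h.le (mem_of_mem_nhds hx) hyU
  have h3 := h.le hyU (mem_of_mem_nhds hx)
  rw [← neg_sub y x, inner_neg_right] at h3
  have h4 := real_inner_le_norm (g y - g x) (y - x)
  rw [inner_sub_left] at h4
  have h5 : ‖g y - g x‖ * ‖y - x‖ ≤ ε * ‖y - x‖ := by gcongr
  rw [Real.norm_eq_abs, abs_le]
  constructor <;> linarith [mul_nonneg hε.le (norm_nonneg (y - x))]

theorem gradient_eventuallyEq [CompleteSpace V] (h : HasStrictSubgradientOn ψ g U)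
    (hU : IsOpen U) (hg : ContinuousOn g U) {x : V} (hx : x ∈ U) : gradient ψ =ᶠ[𝓝 x] g := by
  filter_upwards [hU.mem_nhds hx] with y hy
  exact (h.hasGradientAt (hU.mem_nhds hy) (hg.continuousAt (hU.mem_nhds hy))).gradient

theorem contDiffAt_two [CompleteSpace V] (h : HasStrictSubgradientOn ψ g U) (hU : IsOpen U)
    (hg : ∀ x ∈ U, ContDiffAt ℝ 1 g x) {x : V} (hx : x ∈ U) : ContDiffAt ℝ 2 ψ x := by
  have : (2 : WithTop ℕ∞) = (1 : ℕ) + 1 := by norm_num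
  rw [this, contDiffAt_succ_iff_hasFDerivAt]
  refine ⟨fun y => InnerProductSpace.toDual ℝ V (g y), ⟨U, hU.mem_nhds hx, fun y hy => ?_⟩, ?_⟩
  · exact (h.hasGradientAt (hU.mem_nhds hy) (hg y hy).continuousAt).hasFDerivAt
  · exact (InnerProductSpace.toDual ℝ V).contDiff.contDiffAt.comp x (by exact_mod_cast hg x hx)

theorem inner_fderiv_nonneg (h : HasStrictSubgradientOn ψ g U) (hU : IsOpen U) {x : V}
    (hx : x ∈ U) {T : V →L[ℝ] V} (hT : HasFDerivAt g T x) (v : V) : 0 ≤ inner ℝ (T v) v := by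
  have hline : HasDerivAt (fun t : ℝ => x + t • v) v 0 := by
    simpa using ((hasDerivAt_id (0 : ℝ)).smul_const v).const_add x
  have hcomp : HasDerivAt (fun t : ℝ => g (x + t • v)) (T v) 0 :=
    HasFDerivAt.comp_hasDerivAt (0 : ℝ) (by simpa using hT) hline
  have hlim := hcomp.tendsto_slope_zero_right
  have hlim' := (hlim.inner (𝕜 := ℝ) (tendsto_const_nhds (x := v)))
  have hmem : ∀ᶠ t : ℝ in 𝓝[>] 0, x + t • v ∈ U :=
    nhdsWithin_le_nhds (hline.continuousAt.eventually_mem (by simpa using hU.mem_nhds hx))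
  refine ge_of_tendsto hlim' ?_
  filter_upwards [hmem, self_mem_nhdsWithin] with t ht htpos
  have htpos : 0 < t := htpos
  have h1 := h.monotone hx ht
  rw [add_sub_cancel_left, inner_smul_right] at h1
  have h2 := nonneg_of_mul_nonneg_right h1 htpos
  simp only [zero_add, zero_smul, add_zero, inner_smul_left, conj_trivial]
  exact mul_nonneg (inv_nonneg.mpr htpos.le) h2

/-! ### The proximal map -/

theorem prox_lt (h : HasStrictSubgradientOn ψ g U) {s q : V} (hs : s ∈ U) (hq : s + g s = q) {t : V}
    (ht : t ∈ U) (hts : t ≠ s) :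
    ψ s + 1 / 2 * ‖s - q‖ ^ 2 < ψ t + 1 / 2 * ‖t - q‖ ^ 2 := by
  have h1 := h s hs t ht hts.symm
  have h2 : t - q = (t - s) + (s - q) := by abel
  have h3 : s - q = -g s := by rw [← hq]; abel
  rw [h2, norm_add_sq_real, h3, inner_neg_right, real_inner_comm]
  have := sq_nonneg ‖t - s‖
  linarith

/-- Minimise ψ + ½‖· − q‖². An affine minorant of ψ bounds the sublevel set, `hK` makes it
relatively compact inside `U`, and stationarity at the minimiser is the equation. -/
theorem exists_prox [CompleteSpace V] (h : HasStrictSubgradientOn ψ g U) (hU : IsOpen U)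
    (hne : U.Nonempty) (hg : ContinuousOn g U)
    (hK : ∀ R C : ℝ, ∃ K ⊆ U, IsCompact K ∧ ∀ y ∈ U, ‖y‖ ≤ R → ψ y ≤ C → y ∈ K) (q : V) :
    ∃ s ∈ U, s + g s = q := by
  have hgrad : ∀ y ∈ U, HasGradientAt ψ (g y) y := fun y hy =>
    h.hasGradientAt (hU.mem_nhds hy) (hg.continuousAt (hU.mem_nhds hy))
  set F : V → ℝ := fun t => ψ t + 1 / 2 * ‖t - q‖ ^ 2 with hF
  obtain ⟨x₀, hx₀⟩ := hne
  set B := ‖g x₀‖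
  set A := 1 / 2 * ‖x₀ - q‖ ^ 2 + B * ‖x₀ - q‖ with hA
  have hA0 : 0 ≤ A := by positivity
  have hB0 : 0 ≤ B := norm_nonneg _
  have hbound : ∀ t ∈ U, F t ≤ F x₀ → ‖t‖ ≤ 2 * B + 1 + 2 * A + ‖q‖ := by
    intro t ht hFt
    have h1 := h.le hx₀ ht
    have h2 := neg_le_of_abs_le (abs_real_inner_le_norm (g x₀) (t - x₀))
    have h3 : ‖t - x₀‖ ≤ ‖t - q‖ + ‖x₀ - q‖ := by
      rw [← sub_sub_sub_cancel_right t x₀ q]; exact norm_sub_le _ _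
    have h4 : B * ‖t - x₀‖ ≤ B * (‖t - q‖ + ‖x₀ - q‖) := by gcongr
    simp only [hF] at hFt
    have h5 : 1 / 2 * ‖t - q‖ ^ 2 ≤ A + B * ‖t - q‖ := by rw [hA]; linarith
    -- If r = ‖t − q‖ exceeded this bound, then r > 1 and r²/2 > (A + B)r ≥ A + Br.
    have h6 : ‖t - q‖ ≤ 2 * B + 1 + 2 * A := by
      by_contra! hcon
      nlinarith
    have h7 := norm_add_le (t - q) q
    rw [sub_add_cancel] at h7
    linarith
  obtain ⟨K, hKU, hKc, hKm⟩ := hK (2 * B + 1 + 2 * A + ‖q‖) (F x₀)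
  have hmemK : ∀ t ∈ U, F t ≤ F x₀ → t ∈ K := fun t ht hFt =>
    hKm t ht (hbound t ht hFt) (le_trans (by simp only [hF]; linarith [sq_nonneg ‖t - q‖]) hFt)
  have hFc : ContinuousOn F K := by
    refine ContinuousOn.add (fun y hy => ?_) (by fun_prop)
    exact (hgrad y (hKU hy)).hasFDerivAt.continuousAt.continuousWithinAt
  obtain ⟨s, hsK, hs⟩ := hKc.exists_isMinOn ⟨x₀, hmemK x₀ hx₀ le_rfl⟩ hFc
  have hmin : ∀ t ∈ U, F s ≤ F t := fun t ht => by
    by_cases hFt : F t ≤ F x₀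
    · exact hs (hmemK t ht hFt)
    · exact (hs (hmemK x₀ hx₀ le_rfl)).trans (not_le.mp hFt).le
  refine ⟨s, hKU hsK, ?_⟩
  have hloc : IsLocalMin F s := by
    filter_upwards [hU.mem_nhds (hKU hsK)] with t ht using hmin t ht
  have hder : HasFDerivAt F (InnerProductSpace.toDual ℝ V (g s)
      + (1 / 2 : ℝ) • (2 • (innerSL ℝ (s - q)).comp (ContinuousLinearMap.id ℝ V))) s :=
    (hgrad s (hKU hsK)).hasFDerivAt.add
      ((((hasFDerivAt_id s).sub_const q).norm_sq).const_mul (1 / 2 : ℝ))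
  have hzero := hloc.hasFDerivAt_eq_zero hder
  have hz : g s + (s - q) = 0 := by
    refine ext_inner_right ℝ fun w => ?_
    have := DFunLike.congr_fun hzero w
    simp at this
    rw [inner_add_left, inner_zero_left, inner_sub_left]
    linarith
  rw [← sub_eq_zero, ← hz]
  abel

variable {σ : V → V}

theorem prox_nonexpansive (h : HasStrictSubgradientOn ψ g U) (hσU : ∀ q, σ q ∈ U)
    (hσ : ∀ q, σ q + g (σ q) = q) (p q : V) : ‖σ p - σ q‖ ≤ ‖p - q‖ := by
  have h1 := h.monotone (hσU q) (hσU p)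
  have h2 : p - q = (σ p - σ q) + (g (σ p) - g (σ q)) := by
    nth_rewrite 1 [← hσ p, ← hσ q]; abel
  have h3 : ‖σ p - σ q‖ ^ 2 ≤ ‖p - q‖ ^ 2 := by
    rw [h2, norm_add_sq_real, real_inner_comm]
    linarith [sq_nonneg ‖g (σ p) - g (σ q)‖]
  exact (pow_le_pow_iff_left₀ (norm_nonneg _) (norm_nonneg _) two_ne_zero).mp h3

theorem continuous_prox (h : HasStrictSubgradientOn ψ g U) (hσU : ∀ q, σ q ∈ U)
    (hσ : ∀ q, σ q + g (σ q) = q) : Continuous σ :=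
  (LipschitzWith.of_dist_le_mul (K := 1) fun p q => by
    simpa [dist_eq_norm] using h.prox_nonexpansive hσU hσ p q).continuous

theorem prox_injective {V : Type*} [AddGroup V] {g σ : V → V}
    (hσ : ∀ q, σ q + g (σ q) = q) : Function.Injective σ := fun p q hpq => by
  rw [← hσ p, ← hσ q, hpq]

theorem isInvertible_id_add [FiniteDimensional ℝ V] {T : V →L[ℝ] V}
    (hT : ∀ v, 0 ≤ inner ℝ (T v) v) :
    (ContinuousLinearMap.id ℝ V + T).IsInvertible := by
  have hinj : Function.Injective (ContinuousLinearMap.id ℝ V + T).toLinearMap := by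
    rw [injective_iff_map_eq_zero]
    intro v hv
    have h1 : inner ℝ (v + T v) v = 0 := by
      have : v + T v = 0 := hv
      rw [this, inner_zero_left]
    rw [inner_add_left, real_inner_self_eq_norm_sq] at h1
    have h2 : ‖v‖ ^ 2 = 0 := le_antisymm (by linarith [hT v]) (sq_nonneg _)
    simpa using h2
  exact ⟨(LinearEquiv.ofInjectiveEndo _ hinj).toContinuousLinearEquiv, by ext v; rfl⟩

/-- σ is already known to be continuous and inverse to s ↦ s + g s, so only invertibility of the
derivative at one point is required. -/
theorem hasFDerivAt_prox [FiniteDimensional ℝ V] (h : HasStrictSubgradientOn ψ g U) (hU : IsOpen U)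
    (hσU : ∀ q, σ q ∈ U) (hσ : ∀ q, σ q + g (σ q) = q) {q : V} {T : V →L[ℝ] V}
    (hT : HasFDerivAt g T (σ q)) :
    HasFDerivAt σ (ContinuousLinearMap.id ℝ V + T).inverse q := by
  obtain ⟨e, he⟩ := isInvertible_id_add (h.inner_fderiv_nonneg hU (hσU q) hT)
  rw [← he, ContinuousLinearMap.inverse_equiv]
  refine HasFDerivAt.of_local_left_inverse (f := fun s => s + g s)
    (h.continuous_prox hσU hσ).continuousAt ?_ (Eventually.of_forall hσ)
  rw [he]
  exact (hasFDerivAt_id _).add hT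

/-- The Moreau envelope is strictly convex. -/
theorem moreau_lt (h : HasStrictSubgradientOn ψ g U) (hσU : ∀ q, σ q ∈ U)
    (hσ : ∀ q, σ q + g (σ q) = q) {p q : V} (hpq : p ≠ q) :
    ψ (σ q) + 1 / 2 * ‖σ q - q‖ ^ 2 + inner ℝ (q - σ q) (p - q)
      < ψ (σ p) + 1 / 2 * ‖σ p - p‖ ^ 2 := by
  have h1 := h (σ q) (hσU q) (σ p) (hσU p) fun h0 => hpq (prox_injective hσ h0).symm
  -- Strictness comes from ψ at the distinct points σ p, σ q; expanding the residual σ p − p about σ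
  -- q − q leaves a discarded square.
  have hg : g (σ q) = q - σ q := eq_sub_of_add_eq' (hσ q)
  rw [hg] at h1
  have h2 : σ p - p = (σ q - q) + ((σ p - p) - (σ q - q)) := by abel
  have h3 : p - q = (σ p - σ q) - ((σ p - p) - (σ q - q)) := by abel
  rw [h2, norm_add_sq_real, h3, inner_sub_right, ← neg_sub q (σ q), inner_neg_left]
  linarith [sq_nonneg ‖(σ p - p) - -(q - σ q)‖]

/-- The Moreau envelope minus half the squared norm is strictly concave. -/
theorem lt_moreau (h : HasStrictSubgradientOn ψ g U) (hσU : ∀ q, σ q ∈ U)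
    (hσ : ∀ q, σ q + g (σ q) = q) {p q : V} (hpq : p ≠ q) :
    ψ (σ p) + 1 / 2 * ‖σ p - p‖ ^ 2
      < ψ (σ q) + 1 / 2 * ‖σ q - q‖ ^ 2 + inner ℝ (q - σ q) (p - q) + 1 / 2 * ‖p - q‖ ^ 2 := by
  -- σ q serves as a competitor in the minimisation problem at `p`.
  have h1 := h.prox_lt (hσU p) (hσ p) (hσU q) fun h0 => hpq (prox_injective hσ h0).symm
  have h2 : σ q - p = (σ q - q) - (p - q) := by abel
  rw [h2, norm_sub_sq_real (σ q - q), ← neg_sub q (σ q), inner_neg_left, norm_neg] at h1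
  rw [norm_sub_rev (σ q) q]
  linarith

end HasStrictSubgradientOn

/-! ### Reduction of the augmented Lagrangian to the proximal map of the barrier -/

namespace EuclideanJordanAlgebra

variable {J : Type*} [NormedAddCommGroup J] [InnerProductSpace ℝ J]

theorem hasStrictSubgradientOn_barrier [FiniteDimensional ℝ J] (E : EuclideanJordanAlgebra J)
    {a : ℝ} (ha : 0 < a) :
    HasStrictSubgradientOn (fun s => a * E.barrier s) (fun s => a • E.barrierGrad s)
      (interior E.cone) :=
  HasStrictSubgradientOn.const_mul (fun _ hx _ hy hxy => barrier_add_inner_lt hx hy hxy) ha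

theorem hasFDerivAt_barrierGrad [FiniteDimensional ℝ J] [CompleteSpace J]
    (E : EuclideanJordanAlgebra J) {s : J}
    (hs : s ∈ interior E.cone) :
    HasFDerivAt E.barrierGrad (fderiv ℝ (gradient E.barrier) s) s := by
  have h : HasStrictSubgradientOn E.barrier E.barrierGrad (interior E.cone) :=
    fun _ hx _ hy hxy => barrier_add_inner_lt hx hy hxy
  rw [(h.gradient_eventuallyEq isOpen_interior (fun y hy =>
    (contDiffAt_barrierGrad_of_mem (n := 1) hy).continuousAt.continuousWithinAt) hs).fderiv_eq]
  exact ((contDiffAt_barrierGrad_of_mem (n := 1) hs).differentiableAt one_ne_zero).hasFDerivAt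

theorem exists_proxMap [FiniteDimensional ℝ J] [CompleteSpace J]
    (E : EuclideanJordanAlgebra J) {a : ℝ} (ha : 0 < a) :
    ∃ σ : J → J, (∀ q, σ q ∈ interior E.cone) ∧ ∀ q, σ q + a • E.barrierGrad (σ q) = q := by
  have h := (E.hasStrictSubgradientOn_barrier ha).exists_prox isOpen_interior
    ⟨_, one_mem_interior_cone⟩ (fun y hy => ((contDiffAt_barrierGrad_of_mem
      (n := 1) hy).continuousAt.const_smul a).continuousWithinAt) (fun R C => by
      obtain ⟨K, hK, hc, hm⟩ := E.exists_isCompact_of_barrier_le R (C / a)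
      exact ⟨K, hK, hc, fun y hy hR hC => hm y hy hR ((le_div_iff₀' ha).mpr hC)⟩)
  choose σ hσ using h
  exact ⟨σ, fun q => (hσ q).1, fun q => (hσ q).2⟩

variable {m : ℕ}

theorem augLagrangian_eq [CompleteSpace J] (E : EuclideanJordanAlgebra J)
    (A : J →L[ℝ] EuclideanSpace ℝ (Fin m)) (b : EuclideanSpace ℝ (Fin m)) (c : J) (μ ρ : ℝ)
    (x : J) (l : EuclideanSpace ℝ (Fin m)) (s : J) :
    E.augLagrangian A b c μ ρ x l s = -ρ * inner ℝ b l - 1 / 2 * ρ ^ 2 * ‖x‖ ^ 2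
      + (ρ * μ * E.barrier s
        + 1 / 2 * ‖s - (c - ContinuousLinearMap.adjoint A l - ρ • x)‖ ^ 2) := by
  have h : s - (c - ContinuousLinearMap.adjoint A l - ρ • x)
      = (ContinuousLinearMap.adjoint A l + s - c) + ρ • x := by abel
  rw [augLagrangian, h, norm_add_sq_real, inner_smul_right, norm_smul, mul_pow, Real.norm_eq_abs,
    sq_abs, real_inner_comm x]
  ring

theorem sMin_eq [FiniteDimensional ℝ J] [CompleteSpace J]
    (E : EuclideanJordanAlgebra J) (A : J →L[ℝ] EuclideanSpace ℝ (Fin m))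
    (b : EuclideanSpace ℝ (Fin m)) (c : J) {μ ρ : ℝ} (hρμ : 0 < ρ * μ) (x : J)
    (l : EuclideanSpace ℝ (Fin m)) {s : J} (hs : s ∈ interior E.cone)
    (hq : s + (ρ * μ) • E.barrierGrad s = c - ContinuousLinearMap.adjoint A l - ρ • x) :
    E.sMin A b c μ ρ x l = s ∧
      (∀ t ∈ interior E.cone, t ≠ s →
        E.augLagrangian A b c μ ρ x l s < E.augLagrangian A b c μ ρ x l t) ∧
      E.eta A b c μ ρ x l = E.augLagrangian A b c μ ρ x l s := by
  have hlt : ∀ t ∈ interior E.cone, t ≠ s →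
      E.augLagrangian A b c μ ρ x l s < E.augLagrangian A b c μ ρ x l t := by
    intro t ht hts
    rw [augLagrangian_eq, augLagrangian_eq]
    linarith [(E.hasStrictSubgradientOn_barrier hρμ).prox_lt hs hq ht hts]
  have hmin : IsMinOn (E.augLagrangian A b c μ ρ x l) (interior E.cone) s := fun t ht => by
    by_cases h : t = s
    · subst h; exact le_refl (E.augLagrangian A b c μ ρ x l t)
    · exact (hlt t ht h).le
  refine ⟨?_, hlt, ?_⟩
  · have hex : ∃ t, t ∈ interior E.cone ∧
        IsMinOn (E.augLagrangian A b c μ ρ x l) (interior E.cone) t := ⟨s, hs, hmin⟩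
    obtain ⟨h1, h2⟩ := Classical.epsilon_spec hex
    by_contra hne
    exact absurd (h2 hs) (not_le.mpr (hlt _ h1 hne))
  · refine IsLeast.csInf_eq ⟨Set.mem_image_of_mem _ hs, ?_⟩
    rintro _ ⟨t, ht, rfl⟩
    exact hmin ht

theorem adjoint_injective_of_surjective [CompleteSpace J]
    (A : J →L[ℝ] EuclideanSpace ℝ (Fin m))
    (hA : Function.Surjective A) : Function.Injective (ContinuousLinearMap.adjoint A) := by
  rw [injective_iff_map_eq_zero]
  intro l hl
  obtain ⟨y, rfl⟩ := hA l
  rw [← inner_self_eq_zero (𝕜 := ℝ), ← ContinuousLinearMap.adjoint_inner_left, hl,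
    inner_zero_left]

/-- The identity H⁻¹W = I − H⁻¹ turns the derivative of q − σ(q) into the stated Hessian in λ. -/
theorem inverse_id_add_apply {H : Type*} [NormedAddCommGroup H] [NormedSpace ℝ H] {W : H →L[ℝ] H}
    (h : (ContinuousLinearMap.id ℝ H + W).IsInvertible) (y : H) :
    (ContinuousLinearMap.id ℝ H + W).inverse (W y)
      = y - (ContinuousLinearMap.id ℝ H + W).inverse y := by
  have h1 : W y = (ContinuousLinearMap.id ℝ H + W) y - y := by simp
  obtain ⟨e, he⟩ := h
  rw [h1, map_sub, ← he, ContinuousLinearMap.inverse_equiv]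
  simp

end EuclideanJordanAlgebra

theorem mainTheorem8 {J : Type*} [NormedAddCommGroup J] [InnerProductSpace ℝ J]
    [FiniteDimensional ℝ J] [CompleteSpace J] (E : EuclideanJordanAlgebra J) {m : ℕ}
    (A : J →L[ℝ] EuclideanSpace ℝ (Fin m)) (hA : Function.Surjective A)
    (b : EuclideanSpace ℝ (Fin m)) (c : J) (μ ρ : ℝ) (hμ : 0 < μ) (hρ : 0 < ρ) :
    -- the objects in the formulas are well defined: `s` is the unique minimizer and `η` the
    -- minimum value, `φ` is twice continuously differentiable at `s`, and `H` is invertible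
    (∀ (x : J) (l : EuclideanSpace ℝ (Fin m)),
      (E.sMin A b c μ ρ x l ∈ interior E.cone ∧
        (∀ t ∈ interior E.cone, t ≠ E.sMin A b c μ ρ x l →
          E.augLagrangian A b c μ ρ x l (E.sMin A b c μ ρ x l)
            < E.augLagrangian A b c μ ρ x l t) ∧
        E.eta A b c μ ρ x l = E.augLagrangian A b c μ ρ x l (E.sMin A b c μ ρ x l)) ∧
      ContDiffAt ℝ 2 E.barrier (E.sMin A b c μ ρ x l) ∧
      (E.opH A b c μ ρ x l).IsInvertible) ∧
    -- gradient and Hessian with respect to `l`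
    (∀ (x : J) (l : EuclideanSpace ℝ (Fin m)),
      HasGradientAt (fun l' => E.eta A b c μ ρ x l') (-(ρ • b) + A (E.zVar A b c μ ρ x l)) l ∧
      HasFDerivAt (gradient fun l' => E.eta A b c μ ρ x l')
        (A ∘L (E.opH A b c μ ρ x l).inverse ∘L E.opW A b c μ ρ x l ∘L
          ContinuousLinearMap.adjoint A) l) ∧
    -- gradient and Hessian with respect to `x`
    (∀ (x : J) (l : EuclideanSpace ℝ (Fin m)),
      HasGradientAt (fun x' => E.eta A b c μ ρ x' l)
        (ρ • (ContinuousLinearMap.adjoint A l + E.sMin A b c μ ρ x l - c)) x ∧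
      HasFDerivAt (gradient fun x' => E.eta A b c μ ρ x' l)
        (-(ρ ^ 2 • (E.opH A b c μ ρ x l).inverse)) x) ∧
    -- strict convexity and strict concavity
    (∀ x : J, StrictConvexOn ℝ Set.univ fun l => E.eta A b c μ ρ x l) ∧
    (∀ l : EuclideanSpace ℝ (Fin m), StrictConcaveOn ℝ Set.univ fun x => E.eta A b c μ ρ x l) := by
  have hρμ : 0 < ρ * μ := mul_pos hρ hμ
  obtain ⟨σ, hσU, hσ⟩ := E.exists_proxMap hρμ
  have hsub := E.hasStrictSubgradientOn_barrier hρμ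
  have hσc : Continuous σ := hsub.continuous_prox hσU hσ
  set q : J → EuclideanSpace ℝ (Fin m) → J := fun x l =>
    c - ContinuousLinearMap.adjoint A l - ρ • x with hq
  have hprops := fun x l => E.sMin_eq A b c hρμ x l (hσU (q x l)) (hσ (q x l))
  have hs : ∀ x l, E.sMin A b c μ ρ x l = σ (q x l) := fun x l => (hprops x l).1
  have hη : ∀ x l, E.eta A b c μ ρ x l = -ρ * inner ℝ b l - 1 / 2 * ρ ^ 2 * ‖x‖ ^ 2
      + (ρ * μ * E.barrier (σ (q x l)) + 1 / 2 * ‖σ (q x l) - q x l‖ ^ 2) := fun x l => by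
    rw [(hprops x l).2.2, E.augLagrangian_eq]
  have hW : ∀ x l, HasFDerivAt (fun s => (ρ * μ) • E.barrierGrad s) (E.opW A b c μ ρ x l)
      (σ (q x l)) := fun x l => by
    rw [EuclideanJordanAlgebra.opW, hs]
    exact (E.hasFDerivAt_barrierGrad (hσU _)).const_smul (ρ * μ)
  have hH : ∀ x l, (E.opH A b c μ ρ x l).IsInvertible := fun x l =>
    HasStrictSubgradientOn.isInvertible_id_add
      (hsub.inner_fderiv_nonneg isOpen_interior (hσU _) (hW x l))
  have hσ' : ∀ x l, HasFDerivAt σ (E.opH A b c μ ρ x l).inverse (q x l) := fun x l =>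
    hsub.hasFDerivAt_prox isOpen_interior hσU hσ (hW x l)
  have hz : ∀ x l, E.zVar A b c μ ρ x l = σ (q x l) - q x l := fun x l => by
    rw [EuclideanJordanAlgebra.zVar, hs]; simp only [hq]; module
  have hconvL : ∀ x, HasStrictSubgradientOn (fun l => E.eta A b c μ ρ x l)
      (fun l => -(ρ • b) + A (E.zVar A b c μ ρ x l)) Set.univ := by
    intro x l _ k _ hlk
    have hdiff : q x k - q x l = -ContinuousLinearMap.adjoint A (k - l) := by
      simp only [hq, map_sub]; abel
    have hne : q x k ≠ q x l := fun h0 => by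
      rw [← sub_eq_zero, hdiff, neg_eq_zero, ← map_zero (ContinuousLinearMap.adjoint A)] at h0
      exact hlk (sub_eq_zero.mp
        (EuclideanJordanAlgebra.adjoint_injective_of_surjective A hA h0)).symm
    have h1 := hsub.moreau_lt hσU hσ hne
    rw [hdiff, inner_neg_right, ContinuousLinearMap.adjoint_inner_right,
      ← neg_sub (σ (q x l)) (q x l), map_neg, inner_neg_left, neg_neg] at h1
    simp only [hη, hz]
    rw [inner_add_left, inner_neg_left, inner_smul_left, inner_sub_right b]
    simp only [conj_trivial]
    linarith
  have hconvX : ∀ l, HasStrictSubgradientOn (fun x => -E.eta A b c μ ρ x l)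
      (fun x => -(ρ • (ContinuousLinearMap.adjoint A l + E.sMin A b c μ ρ x l - c)))
      Set.univ := by
    intro l x _ y _ hxy
    have hdiff : q y l - q x l = -(ρ • (y - x)) := by
      simp only [hq, smul_sub]; abel
    have hne : q y l ≠ q x l := fun h0 => by
      rw [← sub_eq_zero, hdiff, neg_eq_zero] at h0
      exact hxy (sub_eq_zero.mp ((smul_eq_zero.mp h0).resolve_left hρ.ne')).symm
    have h1 := hsub.lt_moreau hσU hσ hne
    have h2 : ContinuousLinearMap.adjoint A l + σ (q x l) - c
        = -(q x l - σ (q x l)) - ρ • x := by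
      simp only [hq]; abel
    -- The quadratic remainder of −½ρ²‖·‖² cancels the ½‖q y l − q x l‖² = ½ρ²‖y − x‖² in
    -- `lt_moreau`.
    have h3 : ‖y‖ ^ 2 = ‖x‖ ^ 2 + 2 * inner ℝ x (y - x) + ‖y - x‖ ^ 2 := by
      rw [← norm_add_sq_real, add_sub_cancel]
    rw [hdiff, inner_neg_right, inner_smul_right, norm_neg, norm_smul, mul_pow, Real.norm_eq_abs,
      sq_abs] at h1
    simp only [hη]
    rw [hs, h2, h3, inner_neg_left, inner_smul_left, inner_sub_left, inner_neg_left,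
      inner_smul_left]
    simp only [conj_trivial]
    linarith
  have hqcL : ∀ x, Continuous fun l => q x l := fun x => by simp only [hq]; fun_prop
  have hqcX : ∀ l, Continuous fun x => q x l := fun l => by simp only [hq]; fun_prop
  have hgradL : ∀ x l, HasGradientAt (fun l' => E.eta A b c μ ρ x l')
      (-(ρ • b) + A (E.zVar A b c μ ρ x l)) l := fun x l => by
    refine (hconvL x).hasGradientAt univ_mem ?_
    simp only [hz]
    have := hqcL x
    exact Continuous.continuousAt (by fun_prop)
  have hgradX : ∀ x l, HasGradientAt (fun x' => E.eta A b c μ ρ x' l)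
      (ρ • (ContinuousLinearMap.adjoint A l + E.sMin A b c μ ρ x l - c)) x := fun x l => by
    have h1 := (hconvX l).hasGradientAt (x := x) univ_mem (by
      simp only [hs]
      have := hqcX l
      exact Continuous.continuousAt (by fun_prop))
    have h2 := h1.hasFDerivAt.neg
    rw [map_neg, neg_neg] at h2
    have h3 : (fun x' => E.eta A b c μ ρ x' l) = -fun x' => -E.eta A b c μ ρ x' l := by
      ext; simp
    rw [hasGradientAt_iff_hasFDerivAt, h3]
    exact h2
  refine ⟨fun x l => ?_, fun x l => ⟨hgradL x l, ?_⟩, fun x l => ⟨hgradX x l, ?_⟩, fun x => ?_,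
    fun l => ?_⟩
  · rw [hs]
    exact ⟨⟨hσU _, (hprops x l).2⟩,
      HasStrictSubgradientOn.contDiffAt_two
        (fun _ hx _ hy hxy => EuclideanJordanAlgebra.barrier_add_inner_lt hx hy hxy)
        isOpen_interior (fun _ hx => EuclideanJordanAlgebra.contDiffAt_barrierGrad_of_mem hx) (hσU _),
      hH x l⟩
  · rw [show (gradient fun l' => E.eta A b c μ ρ x l') = fun l' =>
      -(ρ • b) + A (σ (q x l') - q x l') from funext fun l' => by
        rw [(hgradL x l').gradient, hz]]
    have hqd : HasFDerivAt (fun l' => q x l') (-ContinuousLinearMap.adjoint A) l :=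
      ((ContinuousLinearMap.adjoint A).hasFDerivAt.const_sub c).sub_const (ρ • x)
    have hd := (A.hasFDerivAt.comp l (((hσ' x l).comp l hqd).sub hqd)).const_add (-(ρ • b))
    refine hd.congr_fderiv (ContinuousLinearMap.ext fun k => ?_)
    have hk := EuclideanJordanAlgebra.inverse_id_add_apply (hH x l)
      (ContinuousLinearMap.adjoint A k)
    change A ((E.opH A b c μ ρ x l).inverse (-ContinuousLinearMap.adjoint A k)
      - -ContinuousLinearMap.adjoint A k) = A ((E.opH A b c μ ρ x l).inverse
        (E.opW A b c μ ρ x l (ContinuousLinearMap.adjoint A k)))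
    rw [map_neg, neg_sub_neg]
    exact congrArg A hk.symm
  · rw [show (gradient fun x' => E.eta A b c μ ρ x' l) = fun x' =>
      ρ • (ContinuousLinearMap.adjoint A l + σ (q x' l) - c) from funext fun x' => by
        rw [(hgradX x' l).gradient, hs]]
    have hqd : HasFDerivAt (fun x' => q x' l) (-(ρ • ContinuousLinearMap.id ℝ J)) x :=
      ((hasFDerivAt_id x).const_smul ρ).const_sub (c - ContinuousLinearMap.adjoint A l)
    have hd := ((((hσ' x l).comp x hqd).const_add (ContinuousLinearMap.adjoint A l)).sub_const
      c).const_smul ρ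
    refine hd.congr_fderiv (ContinuousLinearMap.ext fun k => ?_)
    simp [smul_smul, pow_two]
  · exact (hconvL x).strictConvexOn convex_univ
  · exact neg_strictConvexOn_iff.mp ((hconvX l).strictConvexOn convex_univ)
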